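/- An instance of the Workflow Satisfiability Problem (WSP) consists of a finite partially ordered set $(S,\leqslant)$ of $k$ steps, a set $U$ of $n$ users, an authorization relation $A \subseteq S \times U$ such that for every $s \in S$ there is a user $u$ with $(s,u) \in A$, and a finite collection $C$ of $c$ constraints. A plan is a function $\pi : S \to U$; it is valid if $(s,\pi(s)) \in A$ for all $s \in S$ and $\pi$ satisfies all constraints in $C$. To solve WSP is to output a valid plan, or to report correctly that there is none. In $\mathrm{WSP}(=)$ all constraints have the form $(=,S_1,S_2)$ with arbitrary $S_1,S_2 \subseteq S$ (Type 3 constraints); a plan $\pi$ satisfies $(=,S_1,S_2)$ if $\pi(s_1)=\pi(s_2)$ for some $s_1 \in S_1$ and $s_2 \in S_2$. In $\mathrm{WSP}_2(=)$, moreover, at least one of $S_1,S_2$ is a singleton in every constraint. Time is measured on a random access machine with logarithmic cost, and $\widetilde{O}(T)$ means $O(T\log^d T)$ for some constant $d$. Theorem. (1) $\mathrm{WSP}_2(=)$ can be solved in time $\widetilde{O}(2^k(c+n^2))$. (2) $\mathrm{WSP}(=)$ can be solved in time $\widetilde{O}(2^{k+c}(c+n^2))$. (3) From every instance of $\mathrm{WSP}(=)$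 one can delete constraints so that at most $3^k$ constraints remain and the set of valid plans is unchanged. (4) $\mathrm{WSP}(=)$ is fixed-parameter tractable with parameter $k$: it can be solved in time $O(f(k)N^d)$, where $N$ is the size of the input, $f$ is a computable function of $k$ alone and $d$ is a constant. -/

import Mathlib

namespace WSP

/-! ### Workflows, constraints and plans -/

/-- An entailment constraint `(ρ, S', S'')` on steps `S` and users `U`. -/
structure EntailmentConstraint (S U : Type) where
  rel : U → U → Prop
  left : Finset S
  right : Finset S

/-- A plan satisfies `(ρ, S', S'')` iff `(π s', π s'') ∈ ρ` for some `s' ∈ S'`, `s'' ∈ S''`. -/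
def EntailmentConstraint.Satisfied {S U : Type} (γ : EntailmentConstraint S U) (π : S → U) : Prop :=
  ∃ s ∈ γ.left, ∃ t ∈ γ.right, γ.rel (π s) (π t)

/-- Type 2: at least one of the two sets is a singleton (so Type 1 is a special case).
Type 3 constraints are arbitrary. -/
def EntailmentConstraint.IsType2 {S U : Type} (γ : EntailmentConstraint S U) : Prop :=
  γ.left.card = 1 ∨ γ.right.card = 1

/-- A constrained workflow authorization schema `(S, U, ≤, A, C)` with entailment constraints.
Every step has an authorized user. The constraints are given as a list; repetitions are allowed. -/
structure Schema (S U : Type) where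
  order : PartialOrder S
  auth : S → U → Prop
  exists_auth : ∀ s, ∃ u, auth s u
  constraints : List (EntailmentConstraint S U)

/-- A plan is valid if it is authorized and satisfies all constraints. -/
def Schema.Valid {S U : Type} (W : Schema S U) (π : S → U) : Prop :=
  (∀ s, W.auth s (π s)) ∧ ∀ γ ∈ W.constraints, γ.Satisfied π

/-- The same schema with the constraints replaced by `C`. -/
def Schema.withConstraints {S U : Type} (W : Schema S U) (C : List (EntailmentConstraint S U)) :
    Schema S U where
  order := W.order
  auth := W.auth
  exists_auth := W.exists_auth
  constraints := C

/-- An instance of the workflow satisfiability problem: `k` steps, `n` users and a schema. -/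
structure Instance where
  k : ℕ
  n : ℕ
  schema : Schema (Fin k) (Fin n)

/-- The number of constraints. -/
def Instance.c (I : Instance) : ℕ := I.schema.constraints.length

/-- `WSP(=)`: all constraints have the form `(=, S', S'')`. -/
def WSPEq (I : Instance) : Prop :=
  ∀ γ ∈ I.schema.constraints, γ.rel = Eq

/-- `WSP₂(=)`: moreover all constraints are of Type 2 (or 1). -/
def WSP2Eq (I : Instance) : Prop :=
  WSPEq I ∧ ∀ γ ∈ I.schema.constraints, γ.IsType2

/-! ### Random access machine with logarithmic cost

A program uses finitely many arrays (memory segments) of natural numbers, each named by a constant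
of the program and indexed by natural numbers that may be computed at run time. Every elementary
operation costs one plus the binary lengths of all the numbers (operands, addresses, contents)
that it handles. -/

/-- Contents of the memory: array name, index, value. -/
abbrev Memory := ℕ → ℕ → ℕ

inductive Expr where
  | lit (v : ℕ)
  | load (arr : ℕ) (idx : Expr)
  | add (a b : Expr)
  | sub (a b : Expr)
  | mul (a b : Expr)
  | div (a b : Expr)

/-- Subtraction is truncated at `0`, and division rounds down, with `x / 0 = 0`. -/
def Expr.eval (m : Memory) : Expr → ℕ
  | lit v => v
  | load arr idx => m arr (idx.eval m)
  | add a b => a.eval m + b.eval m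
  | sub a b => a.eval m - b.eval m
  | mul a b => a.eval m * b.eval m
  | div a b => a.eval m / b.eval m

/-- Logarithmic cost; `Nat.size` is the binary length. -/
def Expr.cost (m : Memory) : Expr → ℕ
  | lit v => 1 + v.size
  | load arr idx => idx.cost m + (1 + (idx.eval m).size + (m arr (idx.eval m)).size)
  | add a b => a.cost m + b.cost m + (1 + (a.eval m).size + (b.eval m).size)
  | sub a b => a.cost m + b.cost m + (1 + (a.eval m).size + (b.eval m).size)
  | mul a b => a.cost m + b.cost m + (1 + (a.eval m).size + (b.eval m).size)
  | div a b => a.cost m + b.cost m + (1 + (a.eval m).size + (b.eval m).size)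

inductive Program where
  | skip
  | store (arr : ℕ) (idx val : Expr)
  | seq (p q : Program)
  | branch (test : Expr) (p q : Program)
  | loop (test : Expr) (p : Program)

def Memory.write (m : Memory) (arr idx val : ℕ) : Memory :=
  fun a i => if a = arr ∧ i = idx then val else m a i

/-- `Exec p m m' t`: started with memory `m`, the program `p` halts with memory `m'` at cost `t`. -/
inductive Exec : Program → Memory → Memory → ℕ → Prop where
  | skip (m : Memory) : Exec .skip m m 1
  | store (m : Memory) (arr : ℕ) (idx val : Expr) :
      Exec (.store arr idx val) m (m.write arr (idx.eval m) (val.eval m))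
        (idx.cost m + val.cost m + (1 + (idx.eval m).size + (val.eval m).size))
  | seq {p q : Program} {m₁ m₂ m₃ : Memory} {t₁ t₂ : ℕ} :
      Exec p m₁ m₂ t₁ → Exec q m₂ m₃ t₂ → Exec (.seq p q) m₁ m₃ (t₁ + t₂)
  | branch_true {e : Expr} {p q : Program} {m m' : Memory} {t : ℕ} :
      e.eval m ≠ 0 → Exec p m m' t →
      Exec (.branch e p q) m m' (e.cost m + (1 + (e.eval m).size) + t)
  | branch_false {e : Expr} {p q : Program} {m m' : Memory} {t : ℕ} :
      e.eval m = 0 → Exec q m m' t →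
      Exec (.branch e p q) m m' (e.cost m + (1 + (e.eval m).size) + t)
  | loop_true {e : Expr} {p : Program} {m₁ m₂ m₃ : Memory} {t₁ t₂ : ℕ} :
      e.eval m₁ ≠ 0 → Exec p m₁ m₂ t₁ → Exec (.loop e p) m₂ m₃ t₂ →
      Exec (.loop e p) m₁ m₃ (e.cost m₁ + (1 + (e.eval m₁).size) + t₁ + t₂)
  | loop_false {e : Expr} {p : Program} {m : Memory} :
      e.eval m = 0 → Exec (.loop e p) m m (e.cost m + (1 + (e.eval m).size))

/-- The machine is deterministic: result and cost are determined by program and input. -/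
theorem Exec.unique {p : Program} {m m₁ m₂ : Memory} {t₁ t₂ : ℕ}
    (h₁ : Exec p m m₁ t₁) (h₂ : Exec p m m₂ t₂) : m₁ = m₂ ∧ t₁ = t₂ := by
  induction h₁ generalizing m₂ t₂ with
  | skip m => cases h₂; exact ⟨rfl, rfl⟩
  | store m arr idx val => cases h₂; exact ⟨rfl, rfl⟩
  | seq _ _ ih₁ ih₂ =>
    cases h₂ with
    | seq a b =>
      obtain ⟨rfl, rfl⟩ := ih₁ a
      obtain ⟨rfl, rfl⟩ := ih₂ b
      exact ⟨rfl, rfl⟩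
  | branch_true he _ ih =>
    cases h₂ with
    | branch_true _ a => obtain ⟨rfl, rfl⟩ := ih a; exact ⟨rfl, rfl⟩
    | branch_false hf _ => exact absurd hf he
  | branch_false he _ ih =>
    cases h₂ with
    | branch_true hf _ => exact absurd he hf
    | branch_false _ a => obtain ⟨rfl, rfl⟩ := ih a; exact ⟨rfl, rfl⟩
  | loop_true he _ _ ih₁ ih₂ =>
    cases h₂ with
    | loop_true _ a b =>
      obtain ⟨rfl, rfl⟩ := ih₁ a
      obtain ⟨rfl, rfl⟩ := ih₂ b
      exact ⟨rfl, rfl⟩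
    | loop_false hf => exact absurd hf he
  | loop_false he =>
    cases h₂ with
    | loop_true hf _ _ => exact absurd he hf
    | loop_false _ => exact ⟨rfl, rfl⟩

/-! ### Input, output and running times -/

open Classical in
/-- The bit that stands for the truth value of `p`. -/
noncomputable def bit (p : Prop) : ℕ := if p then 1 else 0

/-- The input as a sequence of numbers: `k`, `n`, `c`, the `k × k` table of the order, the `k × n`
table of the authorization relation, and for each constraint the characteristic vectors of its two
sets of steps. (In `WSP(=)` the relation of every constraint is known to be `=`.) -/
noncomputable def Instance.encode (I : Instance) : List ℕ :=
  [I.k, I.n, I.c]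
    ++ (List.finRange I.k).flatMap
        (fun s => (List.finRange I.k).map fun t => bit (I.schema.order.le s t))
    ++ (List.finRange I.k).flatMap
        (fun s => (List.finRange I.n).map fun u => bit (I.schema.auth s u))
    ++ I.schema.constraints.flatMap
        (fun γ => (List.finRange I.k).map (fun s => bit (s ∈ γ.left))
          ++ (List.finRange I.k).map (fun s => bit (s ∈ γ.right)))

/-- The size of the input, in bits, counting one separator for each number. -/
noncomputable def Instance.inputSize (I : Instance) : ℕ :=
  (I.encode.map fun v => v.size + 1).sum

/-- Initially array `0` holds the input, and all other cells are `0`. -/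
noncomputable def Instance.initial (I : Instance) : Memory :=
  fun arr i => if arr = 0 then I.encode.getD i 0 else 0

/-- The output is in array `1`: either the number `1` followed by the values of a valid plan,
or the number `0`, if there is no valid plan. -/
def Instance.CorrectOutput (I : Instance) (m : Memory) : Prop :=
  (∃ π : Fin I.k → Fin I.n, I.schema.Valid π ∧ m 1 0 = 1 ∧
    ∀ s : Fin I.k, m 1 ((s : ℕ) + 1) = (π s : ℕ)) ∨
  ((¬ ∃ π : Fin I.k → Fin I.n, I.schema.Valid π) ∧ m 1 0 = 0)

/-- Some program solves all the instances `I` in the class `Q`, each at cost at most `T I`. -/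
def SolvableInTime (Q : Instance → Prop) (T : Instance → ℕ) : Prop :=
  ∃ p : Program, ∀ I : Instance, Q I →
    ∃ (m : Memory) (t : ℕ), Exec p I.initial m t ∧ I.CorrectOutput m ∧ t ≤ T I

/-- Solvable in time `Õ(T)`, that is, `O(T log^d T)` for some constant `d`. The shifts of `T` by a
constant matter only for `T = 0` and `T = 1`. -/
def SolvableInSoftO (Q : Instance → Prop) (T : Instance → ℕ) : Prop :=
  ∃ K d : ℕ, SolvableInTime Q fun I => K * (T I + 1) * (Nat.log 2 (T I + 2)) ^ d

/-- Fixed-parameter tractable in the number `k` of steps: solvable in time `f(k) N^d`, where `N` is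
the size of the input, `f` is a computable function and `d` is a constant. -/
def IsFPT (Q : Instance → Prop) : Prop :=
  ∃ f : ℕ → ℕ, Computable f ∧ ∃ d : ℕ, SolvableInTime Q fun I => f I.k * I.inputSize ^ d

end WSP

/-!
Enlarge the set of steps to a ground set of size `K` such that a plan is valid if and only if it
extends to a partition of the ground set into one block for each user, where a block is admissible
for a user by a condition on that block alone. For a Type 2 constraint no enlargement is needed: the
block that contains the step of the singleton has to meet the other set. A Type 3 constraint gets an
extra element, whose block has to meet both sets. Two constraints with the same pair of sets can
share this element, so `4 ^ k` extra elements always suffice.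

The number of these partitions is computed with arithmetic operations on long words. Give an
admissible block `V` the weight `B ^ |V|`, where `B` exceeds the number of all assignments. The
product over the users of the subset sums of the weights, with the signs of inclusion–exclusion,
summed over all subsets of the ground set, counts the tuples of blocks that cover the ground set;
modulo `B ^ (K + 1)` only the tuples of total size `K` survive, and these are the partitions. The
subset sums take `K * 2 ^ K` additions. A plan is found step by step, by deciding whether a partial
plan can be extended.
-/

namespace WSP

/-- A constant `w` such that the value of the expression has at most `w * (L + 1)` bits
in a memory whose cells have at most `L` bits. -/
def Expr.sizeWeight : Expr → ℕ
  | lit v => v.size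
  | load _ _ => 1
  | add a b => a.sizeWeight + b.sizeWeight + 1
  | sub a _ => a.sizeWeight
  | mul a b => a.sizeWeight + b.sizeWeight
  | div a _ => a.sizeWeight

/-- A constant `w` such that evaluating the expression costs at most `w * (L + 1)`
in a memory whose cells have at most `L` bits. -/
def Expr.weight : Expr → ℕ
  | lit v => 1 + v.size
  | load _ idx => idx.weight + (2 + idx.sizeWeight)
  | add a b => a.weight + b.weight + (1 + a.sizeWeight + b.sizeWeight)
  | sub a b => a.weight + b.weight + (1 + a.sizeWeight + b.sizeWeight)
  | mul a b => a.weight + b.weight + (1 + a.sizeWeight + b.sizeWeight)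
  | div a b => a.weight + b.weight + (1 + a.sizeWeight + b.sizeWeight)

/-- The weight of an expression that is evaluated as a test. -/
def Expr.testWeight (e : Expr) : ℕ := e.weight + (1 + e.sizeWeight)

/-- A constant `w` such that every elementary step of the program costs at most `w * (L + 1)`
as long as the cells have at most `L` bits. -/
def Program.weight : Program → ℕ
  | skip => 1
  | store _ idx val => idx.weight + val.weight + (1 + idx.sizeWeight + val.sizeWeight)
  | seq p q => p.weight + q.weight
  | branch e p q => e.testWeight + p.weight + q.weight
  | loop e p => e.testWeight + p.weight

/-- All cells are less than `2 ^ L`. -/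
def Memory.Bounded (L : ℕ) (m : Memory) : Prop := ∀ a i, m a i < 2 ^ L

theorem size_add_le (a b : ℕ) : (a + b).size ≤ a.size + b.size + 1 := by
  rw [Nat.size_le, pow_succ, mul_two]
  exact add_lt_add
    ((Nat.lt_size_self a).trans_le (Nat.pow_le_pow_right two_pos (Nat.le_add_right _ _)))
    ((Nat.lt_size_self b).trans_le (Nat.pow_le_pow_right two_pos (Nat.le_add_left _ _)))

theorem size_mul_le (a b : ℕ) : (a * b).size ≤ a.size + b.size := by
  rw [Nat.size_le, pow_add]
  exact Nat.mul_lt_mul'' (Nat.lt_size_self a) (Nat.lt_size_self b)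

section Cost

variable {L : ℕ} {m : Memory}

theorem Expr.size_eval_le (hm : m.Bounded L) (e : Expr) :
    (e.eval m).size ≤ e.sizeWeight * (L + 1) := by
  induction e with
  | lit v => exact Nat.le_mul_of_pos_right _ L.succ_pos
  | load arr idx _ =>
    rw [sizeWeight, one_mul]
    exact (Nat.size_le.2 (hm arr (idx.eval m))).trans L.le_succ
  | add a b iha ihb =>
    rw [sizeWeight, eval, add_mul, add_mul, one_mul]
    exact (size_add_le _ _).trans (by lia)
  | sub a b iha _ => exact (Nat.size_le_size (Nat.sub_le _ _)).trans iha
  | mul a b iha ihb =>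
    rw [sizeWeight, eval, add_mul]
    exact (size_mul_le _ _).trans (add_le_add iha ihb)
  | div a b iha _ => exact (Nat.size_le_size (Nat.div_le_self _ _)).trans iha

theorem Expr.cost_le (hm : m.Bounded L) (e : Expr) : e.cost m ≤ e.weight * (L + 1) := by
  induction e with
  | lit v => exact Nat.le_mul_of_pos_right _ L.succ_pos
  | load arr idx ih =>
    have hcell := Nat.size_le.2 (hm arr (idx.eval m))
    have hidx := idx.size_eval_le hm
    simp only [cost, weight]
    linarith
  | add a b iha ihb | sub a b iha ihb | mul a b iha ihb | div a b iha ihb =>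
    have ha := a.size_eval_le hm
    have hb := b.size_eval_le hm
    simp only [cost, weight]
    linarith

theorem Expr.test_cost_le (hm : m.Bounded L) (e : Expr) :
    e.cost m + (1 + (e.eval m).size) ≤ e.testWeight * (L + 1) := by
  have hcost := e.cost_le hm
  have hsize := e.size_eval_le hm
  rw [testWeight]
  linarith

end Cost

/-- The arrays that a program may write to. -/
@[simp]
def Program.writes : Program → List ℕ
  | skip => []
  | store arr _ _ => [arr]
  | seq p q => p.writes ++ q.writes
  | branch _ p q => p.writes ++ q.writes
  | loop _ p => p.writes

/-- Memories that agree on all arrays outside a list. -/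
def AgreeOff (w : List ℕ) (m m' : Memory) : Prop := ∀ a, a ∉ w → m' a = m a

theorem AgreeOff.trans {v w x : List ℕ} {m₁ m₂ m₃ : Memory} (h₁ : AgreeOff v m₁ m₂)
    (h₂ : AgreeOff w m₂ m₃) (hv : v ⊆ x) (hw : w ⊆ x) : AgreeOff x m₁ m₃ :=
  fun a ha => (h₂ a fun h => ha (hw h)).trans (h₁ a fun h => ha (hv h))

@[simp]
theorem Memory.write_same (m : Memory) (arr idx val : ℕ) :
    m.write arr idx val arr = Function.update (m arr) idx val := by
  funext i
  simp [Memory.write, Function.update_apply]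

@[simp]
theorem Memory.write_of_ne {a arr : ℕ} (h : a ≠ arr) (m : Memory) (idx val : ℕ) :
    m.write arr idx val a = m a := by
  funext i
  simp [Memory.write, h]

theorem agreeOff_write (m : Memory) (arr idx val : ℕ) : AgreeOff [arr] m (m.write arr idx val) :=
  fun _ ha => Memory.write_of_ne (List.ne_of_not_mem_cons ha) m idx val

theorem Exec.agreeOff {p : Program} {m m' : Memory} {t : ℕ} (h : Exec p m m' t) :
    AgreeOff p.writes m m' := by
  induction h with
  | skip m => exact fun _ _ => rfl
  | store m arr idx val => exact agreeOff_write _ _ _ _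
  | seq _ _ ih₁ ih₂ =>
    exact ih₁.trans ih₂ (List.subset_append_left _ _) (List.subset_append_right _ _)
  | branch_true _ _ ih => exact fun a ha => ih a fun h => ha (List.mem_append_left _ h)
  | branch_false _ _ ih => exact fun a ha => ih a fun h => ha (List.mem_append_right _ h)
  | loop_true _ _ _ ih₁ ih₂ => exact ih₁.trans ih₂ (List.Subset.refl _) (List.Subset.refl _)
  | loop_false _ => exact fun _ _ => rfl

/-- Started with cells below `2 ^ L`, the program halts after at most `τ` elementary steps, all
cells stay below `2 ^ L`, and the final memory satisfies `Q`. -/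
def Runs (L : ℕ) (p : Program) (m : Memory) (τ : ℕ) (Q : Memory → Prop) : Prop :=
  m.Bounded L → ∃ m' t, Exec p m m' t ∧ t ≤ p.weight * (L + 1) * τ ∧ m'.Bounded L ∧ Q m'

namespace Runs

variable {L τ τ₁ τ₂ : ℕ} {p q : Program} {m : Memory} {Q R : Memory → Prop}

theorem conseq (h : Runs L p m τ₁ R) (hτ : τ₁ ≤ τ)
    (hQ : ∀ m', AgreeOff p.writes m m' → R m' → Q m') : Runs L p m τ Q := fun hm =>
  have ⟨m', t, he, ht, hb, hr⟩ := h hm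
  ⟨m', t, he, ht.trans (Nat.mul_le_mul_left _ hτ), hb, hQ m' he.agreeOff hr⟩

theorem mono (h : Runs L p m τ₁ Q) (hτ : τ₁ ≤ τ) : Runs L p m τ Q :=
  h.conseq hτ fun _ _ => id

theorem skip (hQ : Q m) : Runs L .skip m 1 Q := fun hm =>
  ⟨m, 1, .skip m, by simp [Program.weight], hm, hQ⟩

theorem store {arr : ℕ} {idx val : Expr} (hv : val.eval m < 2 ^ L)
    (hQ : Q (m.write arr (idx.eval m) (val.eval m))) : Runs L (.store arr idx val) m 1 Q := by
  refine fun hm => ⟨_, _, .store m arr idx val, ?_, fun a i => ?_, hQ⟩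
  · have hidx := idx.cost_le hm
    have hval := val.cost_le hm
    have hidx_size := idx.size_eval_le hm
    have hval_size := val.size_eval_le hm
    rw [Program.weight]
    linarith
  · rw [Memory.write]
    split_ifs
    exacts [hv, hm a i]

theorem seq (hp : Runs L p m τ₁ R)
    (hq : ∀ m', AgreeOff p.writes m m' → R m' → Runs L q m' τ₂ Q) :
    Runs L (.seq p q) m (τ₁ + τ₂) Q := by
  intro hm
  obtain ⟨m', t, he, ht, hb, hr⟩ := hp hm
  obtain ⟨m'', t', he', ht', hb', hr'⟩ := hq m' he.agreeOff hr hb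
  refine ⟨m'', t + t', he.seq he', ?_, hb', hr'⟩
  calc t + t' ≤ p.weight * (L + 1) * τ₁ + q.weight * (L + 1) * τ₂ := add_le_add ht ht'
    _ ≤ (p.weight + q.weight) * (L + 1) * τ₁ + (p.weight + q.weight) * (L + 1) * τ₂ := by
      gcongr <;> lia
    _ = (Program.seq p q).weight * (L + 1) * (τ₁ + τ₂) := (mul_add _ _ _).symm

theorem budget {c t w w' W : ℕ} (hc : c ≤ w * (L + 1)) (ht : t ≤ w' * (L + 1) * τ)
    (hw : w ≤ W) (hw' : w' ≤ W) : c + t ≤ W * (L + 1) * (1 + τ) := by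
  rw [mul_add, mul_one]
  exact add_le_add (hc.trans (Nat.mul_le_mul_right _ hw)) (ht.trans (by gcongr))

theorem branch {e : Expr} (hp : e.eval m ≠ 0 → Runs L p m τ Q)
    (hq : e.eval m = 0 → Runs L q m τ Q) : Runs L (.branch e p q) m (1 + τ) Q := by
  intro hm
  by_cases h : e.eval m = 0
  · obtain ⟨m', t, he, ht, hb, hr⟩ := hq h hm
    exact ⟨m', _, .branch_false h he,
      budget (e.test_cost_le hm) ht (by rw [Program.weight]; lia) (Nat.le_add_left _ _), hb, hr⟩
  · obtain ⟨m', t, he, ht, hb, hr⟩ := hp h hm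
    exact ⟨m', _, .branch_true h he,
      budget (e.test_cost_le hm) ht (by rw [Program.weight]; lia)
        (by rw [Program.weight]; lia), hb, hr⟩

theorem loop {e : Expr} (Inv : ℕ → Memory → Prop) (N : ℕ)
    (htest : ∀ j m', Inv j m' → (e.eval m' = 0 ↔ N ≤ j))
    (hstep : ∀ j m', j < N → Inv j m' → Runs L p m' τ (Inv (j + 1)))
    (j : ℕ) (hj : j ≤ N) (hI : Inv j m) :
    Runs L (.loop e p) m ((N - j) * (1 + τ) + 1) (Inv N) := by
  induction hj using Nat.decreasingInduction generalizing m with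
  | self =>
    refine fun hm => ⟨m, _, .loop_false ((htest N m hI).2 le_rfl), ?_, hm, hI⟩
    rw [Nat.sub_self, zero_mul, zero_add, mul_one]
    exact (e.test_cost_le hm).trans (Nat.mul_le_mul_right _ (Nat.le_add_right _ _))
  | of_succ j hj ih =>
    intro hm
    obtain ⟨m', t, he, ht, hb, hI'⟩ := hstep j m hj hI hm
    obtain ⟨m'', t', he', ht', hb', hI''⟩ := ih hI' hb
    have hne : e.eval m ≠ 0 := fun h => hj.not_ge ((htest j m hI).1 h)
    refine ⟨m'', _, .loop_true hne he he', ?_, hb', hI''⟩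
    calc _ ≤ (Program.loop e p).weight * (L + 1) * (1 + τ)
          + (Program.loop e p).weight * (L + 1) * ((N - (j + 1)) * (1 + τ) + 1) :=
        add_le_add (budget (e.test_cost_le hm) ht (Nat.le_add_right _ _) (Nat.le_add_left _ _)) ht'
      _ = (Program.loop e p).weight * (L + 1) * ((N - (j + 1) + 1) * (1 + τ) + 1) := by ring
      _ = _ := by rw [← Nat.sub_sub, Nat.sub_add_cancel (Nat.sub_pos_of_lt hj)]

end Runs

/-- Sequential composition of programs. -/
infixr:65 " ;; " => Program.seq

/-- The scalar held at index `0` of an array. -/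
def Expr.var (a : ℕ) : Expr := .load a (.lit 0)

@[simp]
theorem Expr.eval_var (m : Memory) (a : ℕ) : (Expr.var a).eval m = m a 0 := rfl

/-- The remainder of an integer division. -/
def Expr.mod (a b : Expr) : Expr := .sub a (.mul b (.div a b))

@[simp]
theorem Expr.eval_mod (m : Memory) (a b : Expr) :
    (Expr.mod a b).eval m = a.eval m % b.eval m := by
  simp only [Expr.mod, Expr.eval]
  exact (Nat.mod_eq_sub _ _).symm

/-- Expressions serve as tests: a value other than `0` stands for truth. -/
def Expr.Holds (e : Expr) (m : Memory) : Prop := e.eval m ≠ 0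

/-- Negation of a test. -/
def Expr.not (e : Expr) : Expr := .sub (.lit 1) e

/-- The test `a < b`. -/
def Expr.lt (a b : Expr) : Expr := .sub b a

/-- The test `a ≠ b`. -/
def Expr.ne (a b : Expr) : Expr := .add (.sub a b) (.sub b a)

/-- The truth value of a test as a number `0` or `1`. -/
def Expr.indicator (e : Expr) : Expr := e.not.not

section Tests

variable (m : Memory) (a b e : Expr)

@[simp]
theorem Expr.holds_not : e.not.Holds m ↔ ¬ e.Holds m := by
  simp only [Holds, not, eval]
  lia

@[simp]
theorem Expr.holds_lt : (a.lt b).Holds m ↔ a.eval m < b.eval m := by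
  simp only [Holds, lt, eval]
  lia

@[simp]
theorem Expr.holds_ne : (a.ne b).Holds m ↔ a.eval m ≠ b.eval m := by
  simp only [Holds, ne, eval]
  lia

@[simp]
theorem Expr.holds_mul : (Expr.mul a b).Holds m ↔ a.Holds m ∧ b.Holds m := mul_ne_zero_iff

@[simp]
theorem Expr.holds_add : (Expr.add a b).Holds m ↔ a.Holds m ∨ b.Holds m := by
  simp only [Holds, eval]
  lia

@[simp]
theorem Expr.eval_indicator : e.indicator.eval m = bit (e.Holds m) := by
  simp only [indicator, not, eval, Holds, bit]
  split_ifs <;> lia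

@[simp]
theorem bit_ne_zero {p : Prop} : bit p ≠ 0 ↔ p := by simp [bit]

theorem bit_le_one (p : Prop) : bit p ≤ 1 := by
  rw [bit]
  split_ifs <;> lia

theorem sum_bit {α : Type*} [Fintype α] (p : α → Prop) [DecidablePred p] :
    ∑ a, bit (p a) = (Finset.univ.filter p).card := by
  rw [Finset.card_filter]
  exact Finset.sum_congr rfl fun a _ => by by_cases h : p a <;> simp [bit, h]

end Tests

namespace Program

/-- `for i = 0, …, bound - 1 do p`. -/
def forLoop (i : ℕ) (bound : Expr) (p : Program) : Program :=
  .store i (.lit 0) (.lit 0) ;;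
    .loop (.lt (.var i) bound) (p ;; .store i (.lit 0) (.add (.var i) (.lit 1)))

/-- `acc := init; for i = 0, …, bound - 1 do { p; acc := val }`. -/
def fold (acc i : ℕ) (bound init : Expr) (p : Program) (val : Expr) : Program :=
  .store acc (.lit 0) init ;; forLoop i bound (p ;; .store acc (.lit 0) val)

/-- `acc := 0; for i = 0, …, bound - 1 do { p; acc := acc + val }`. -/
def sum (acc i : ℕ) (bound : Expr) (p : Program) (val : Expr) : Program :=
  fold acc i bound (.lit 0) p (.add (.var acc) val)

/-- `acc := init; for i = 0, …, bound - 1 do { p; acc := acc * val % modulus }`. -/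
def prodMod (acc i : ℕ) (bound init : Expr) (p : Program) (val modulus : Expr) : Program :=
  fold acc i bound init p (.mod (.mul (.var acc) val) modulus)

/-- `for i = 0, …, bound - 1 do { p; arr[off + i] := val }`. -/
def tabulate (arr i : ℕ) (bound off : Expr) (p : Program) (val : Expr) : Program :=
  forLoop i bound (p ;; .store arr (.add off (.var i)) val)

/-- Stores the powers of `base` with exponents `0, …, bound` in the array `arr`. -/
def powers (arr i : ℕ) (bound base : Expr) : Program :=
  .store arr (.lit 0) (.lit 1) ;;
    tabulate arr i bound (.lit 1) .skip (.mul (.load arr (.var i)) base)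

@[simp]
theorem mem_writes_forLoop {a i : ℕ} {bound : Expr} {p : Program} :
    a ∈ (forLoop i bound p).writes ↔ a = i ∨ a ∈ p.writes := by
  simp only [forLoop, writes, List.mem_append, List.mem_singleton]
  tauto

@[simp]
theorem mem_writes_fold {a acc i : ℕ} {bound init val : Expr} {p : Program} :
    a ∈ (fold acc i bound init p val).writes ↔ a = acc ∨ a = i ∨ a ∈ p.writes := by
  simp only [fold, writes, List.mem_append, List.mem_singleton, mem_writes_forLoop]
  tauto

@[simp]
theorem mem_writes_sum {a acc i : ℕ} {bound val : Expr} {p : Program} :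
    a ∈ (sum acc i bound p val).writes ↔ a = acc ∨ a = i ∨ a ∈ p.writes :=
  mem_writes_fold

@[simp]
theorem mem_writes_prodMod {a acc i : ℕ} {bound init val modulus : Expr} {p : Program} :
    a ∈ (prodMod acc i bound init p val modulus).writes ↔ a = acc ∨ a = i ∨ a ∈ p.writes :=
  mem_writes_fold

@[simp]
theorem mem_writes_tabulate {a arr i : ℕ} {bound off val : Expr} {p : Program} :
    a ∈ (tabulate arr i bound off p val).writes ↔ a = i ∨ a ∈ p.writes ∨ a = arr := by
  simp [tabulate]

@[simp]
theorem mem_writes_powers {a arr i : ℕ} {bound base : Expr} :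
    a ∈ (powers arr i bound base).writes ↔ a = arr ∨ a = i := by
  simp only [powers, writes, List.mem_append, List.mem_singleton, mem_writes_tabulate,
    List.not_mem_nil]
  tauto

end Program

namespace Runs

variable {L τ i acc arr N : ℕ} {bound init val : Expr} {p : Program} {m : Memory}

theorem forLoop (Inv : ℕ → Memory → Prop) (hi : i ∉ p.writes)
    (hbound : ∀ m', AgreeOff (i :: p.writes) m m' → bound.eval m' = N) (hN : N < 2 ^ L)
    (hwrite : ∀ j m' x, Inv j m' → Inv j (m'.write i 0 x)) (hInv : Inv 0 m)
    (hstep : ∀ j m', j < N → AgreeOff (i :: p.writes) m m' → m' i 0 = j → Inv j m' →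
      Runs L p m' τ (Inv (j + 1))) :
    Runs L (.forLoop i bound p) m (N * (τ + 2) + 2) (Inv N) := by
  have hsub : [i] ⊆ i :: p.writes := by simp
  refine mono (τ₁ := 1 + ((N - 0) * (1 + (τ + 1)) + 1)) ?_ (by rw [Nat.sub_zero]; lia)
  refine seq (store (by simp [Expr.eval]) rfl) ?_
  rintro _ - rfl
  refine (loop (fun j m' => AgreeOff (i :: p.writes) m m' ∧ m' i 0 = j ∧ Inv j m') N
    ?_ ?_ 0 N.zero_le ?_).conseq le_rfl fun m' _ h => h.2.2
  · rintro j m' ⟨hagree, hij, -⟩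
    simp only [Expr.lt, Expr.eval, Expr.eval_var, hbound m' hagree, hij]
    lia
  · rintro j m' hj ⟨hagree, hij, hInv⟩
    refine seq (hstep j m' hj hagree hij hInv) fun m'' hagree' hInv' => ?_
    have hij' : m'' i 0 = j := by rw [hagree' i hi, hij]
    refine store (by simp only [Expr.eval, Expr.eval_var]; lia)
      ⟨?_, by simp [Expr.eval, hij'], hwrite _ _ _ hInv'⟩
    exact (hagree.trans hagree' (List.Subset.refl _) (List.subset_cons_self _ _)).trans
      (agreeOff_write _ _ _ _) (List.Subset.refl _) hsub
  · exact ⟨(agreeOff_write _ _ _ _).trans (fun _ _ => rfl) hsub hsub, by simp [Expr.eval],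
      hwrite _ _ _ hInv⟩

theorem fold (F : ℕ → ℕ) (hacc : acc ≠ i) (hi : i ∉ p.writes)
    (hbound : ∀ m', AgreeOff (i :: acc :: p.writes) m m' → bound.eval m' = N) (hN : N < 2 ^ L)
    (hF : ∀ j ≤ N, F j < 2 ^ L) (hinit : init.eval m = F 0)
    (hstep : ∀ j m', j < N → AgreeOff (i :: acc :: p.writes) m m' → m' i 0 = j → m' acc 0 = F j →
      Runs L p m' τ fun m'' => val.eval m'' = F (j + 1)) :
    Runs L (.fold acc i bound init p val) m (N * (τ + 3) + 3) fun m' => m' acc 0 = F N := by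
  have hsub : i :: (p.writes ++ [acc]) ⊆ i :: acc :: p.writes := by
    intro a
    simp only [List.mem_cons, List.mem_append, List.not_mem_nil]
    tauto
  refine mono (τ₁ := 1 + (N * (τ + 1 + 2) + 2)) ?_ (by lia)
  refine seq (store (by rw [hinit]; exact hF 0 N.zero_le) rfl) ?_
  rintro m₀ hm₀ rfl
  have hagree : ∀ m', AgreeOff (i :: (p.writes ++ [acc])) (m.write acc 0 (F 0)) m' →
      AgreeOff (i :: acc :: p.writes) m m' := fun m' h =>
    (agreeOff_write m acc 0 (F 0)).trans h (by simp) hsub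
  rw [hinit] at hm₀ ⊢
  refine forLoop (fun j m' => m' acc 0 = F j) (by simp [hi, hacc.symm])
    (fun m' h => hbound m' (hagree m' h)) hN (fun j m' x h => by rwa [Memory.write_of_ne hacc])
    (by simp [Expr.eval]) fun j m' hj hm' hij hacc => ?_
  refine seq (hstep j m' hj (hagree m' hm') hij hacc) fun m'' _ hval => ?_
  exact store (by rw [hval]; exact hF _ hj) (by simp [hval, Expr.eval])

theorem sum (f : Fin N → ℕ) (hacc : acc ∉ p.writes) (hacci : acc ≠ i) (hi : i ∉ p.writes)
    (hbound : ∀ m', AgreeOff (i :: acc :: p.writes) m m' → bound.eval m' = N) (hN : N < 2 ^ L)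
    (hf : ∑ j, f j < 2 ^ L)
    (hstep : ∀ (j : Fin N) m', AgreeOff (i :: acc :: p.writes) m m' → m' i 0 = j →
      Runs L p m' τ fun m'' => val.eval m'' = f j) :
    Runs L (.sum acc i bound p val) m (N * (τ + 3) + 3) fun m' => m' acc 0 = ∑ j, f j := by
  set g : ℕ → ℕ := fun j => if h : j < N then f ⟨j, h⟩ else 0 with hg
  have hsum : ∑ j ∈ Finset.range N, g j = ∑ j, f j := by simp [hg, Finset.sum_range]
  rw [← hsum] at hf ⊢
  refine fold (fun j => ∑ x ∈ Finset.range j, g x) hacci hi hbound hN (fun j hj => ?_) rfl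
    fun j m' hj hm' hij hj' => ?_
  · exact (Finset.sum_le_sum_of_subset (Finset.range_mono hj)).trans_lt hf
  · refine (hstep ⟨j, hj⟩ m' hm' hij).conseq le_rfl fun m'' hm'' hval => ?_
    rw [Expr.eval, Expr.eval_var, hm'' acc hacc, hj', hval, Finset.sum_range_succ]
    simp [hg, hj]

theorem sum_skip (f : Fin N → ℕ) (hacci : acc ≠ i)
    (hbound : ∀ m', AgreeOff [i, acc] m m' → bound.eval m' = N) (hN : N < 2 ^ L)
    (hf : ∑ j, f j < 2 ^ L)
    (hval : ∀ (j : Fin N) m', AgreeOff [i, acc] m m' → m' i 0 = j → val.eval m' = f j) :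
    Runs L (.sum acc i bound .skip val) m (N * 4 + 3) fun m' => m' acc 0 = ∑ j, f j :=
  sum f (by simp) hacci (by simp) hbound hN hf fun j m' hm' hij => skip (hval j m' hm' hij)

theorem prodMod {modulus : Expr} {M z : ℕ} (f : Fin N → ℕ) (hacc : acc ∉ p.writes)
    (hacci : acc ≠ i) (hi : i ∉ p.writes)
    (hbound : ∀ m', AgreeOff (i :: acc :: p.writes) m m' → bound.eval m' = N) (hN : N < 2 ^ L)
    (hinit : init.eval m = z) (hz : z < M) (hM : M ≤ 2 ^ L)
    (hstep : ∀ (j : Fin N) m', AgreeOff (i :: acc :: p.writes) m m' → m' i 0 = j →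
      Runs L p m' τ fun m'' => modulus.eval m'' = M ∧ val.eval m'' = f j) :
    Runs L (.prodMod acc i bound init p val modulus) m (N * (τ + 3) + 3)
      fun m' => m' acc 0 = z * (∏ j, f j) % M := by
  set g : ℕ → ℕ := fun j => if h : j < N then f ⟨j, h⟩ else 0 with hg
  have hprod : ∏ j ∈ Finset.range N, g j = ∏ j, f j := by simp [hg, Finset.prod_range]
  rw [← hprod]
  refine fold (fun j => z * (∏ x ∈ Finset.range j, g x) % M) hacci hi hbound hN
    (fun j _ => (Nat.mod_lt _ (by lia)).trans_le hM) (by simp [hinit, Nat.mod_eq_of_lt hz])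
    fun j m' hj hm' hij hj' => ?_
  refine (hstep ⟨j, hj⟩ m' hm' hij).conseq le_rfl fun m'' hm'' ⟨hmod, hval⟩ => ?_
  rw [Expr.eval_mod, Expr.eval, Expr.eval_var, hm'' acc hacc, hj', hval, hmod,
    Finset.prod_range_succ, ← mul_assoc, Nat.mod_mul_mod]
  simp [hg, hj]

theorem tabulate {off : Expr} {o : ℕ} (f : Fin N → ℕ) (harr : arr ∉ p.writes) (harri : arr ≠ i)
    (hi : i ∉ p.writes)
    (hbound : ∀ m', AgreeOff (i :: arr :: p.writes) m m' → bound.eval m' = N) (hN : N < 2 ^ L)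
    (hoff : ∀ m', AgreeOff (i :: arr :: p.writes) m m' → off.eval m' = o)
    (hf : ∀ j, f j < 2 ^ L)
    (hstep : ∀ (j : Fin N) m', AgreeOff (i :: arr :: p.writes) m m' → m' i 0 = j →
      (∀ x < o, m' arr x = m arr x) → (∀ j' < j, m' arr (o + j') = f j') →
      Runs L p m' τ fun m'' => val.eval m'' = f j) :
    Runs L (.tabulate arr i bound off p val) m (N * (τ + 3) + 2) fun m' =>
      (∀ x < o, m' arr x = m arr x) ∧ ∀ j : Fin N, m' arr (o + j) = f j := by
  have hagree : ∀ m', AgreeOff (i :: (p.writes ++ [arr])) m m' →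
      AgreeOff (i :: arr :: p.writes) m m' := fun m' h a ha => h a (by
    simp only [List.mem_cons, List.mem_append, List.not_mem_nil] at ha ⊢
    tauto)
  refine (forLoop (τ := τ + 1) (fun j m' => (∀ x < o, m' arr x = m arr x) ∧
      ∀ j' : Fin N, j' < j → m' arr (o + j') = f j') (by simp [hi, harri.symm])
    (fun m' h => hbound m' (hagree m' h)) hN
    (fun j m' x h => by rwa [Memory.write_of_ne harri]) ⟨fun _ _ => rfl, fun j' h => by lia⟩
    fun j m' hj hm' hij ⟨hlow, htab⟩ => ?_).conseq le_rfl
    fun m' _ h => ⟨h.1, fun j => h.2 j j.isLt⟩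
  refine seq (hstep ⟨j, hj⟩ m' (hagree m' hm') hij hlow htab) fun m'' hm'' hval => ?_
  have hidx : (Expr.add off (.var i)).eval m'' = o + j := by
    rw [Expr.eval, Expr.eval_var, hm'' i hi, hij]
    congr 1
    exact hoff m'' ((hagree m' hm').trans hm'' (List.Subset.refl _) fun a ha => by simp [ha])
  refine store (hval ▸ hf _) ?_
  rw [hidx, hval]
  refine ⟨fun x hx => ?_, fun j' hj' => ?_⟩
  · rw [Memory.write_same, Function.update_of_ne (by lia), hm'' arr harr, hlow x hx]
  · rcases (Nat.lt_succ_iff.1 hj').eq_or_lt with rfl | hlt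
    · rw [Memory.write_same, Function.update_self]
    · rw [Memory.write_same, Function.update_of_ne (by lia), hm'' arr harr, htab j' hlt]

theorem powers {base : Expr} {b : ℕ} (harri : arr ≠ i)
    (hbound : ∀ m', AgreeOff [i, arr] m m' → bound.eval m' = N) (hN : N < 2 ^ L)
    (hbase : ∀ m', AgreeOff [i, arr] m m' → base.eval m' = b) (hb : ∀ j ≤ N, b ^ j < 2 ^ L) :
    Runs L (.powers arr i bound base) m (N * 4 + 3) fun m' => ∀ j ≤ N, m' arr j = b ^ j := by
  refine mono (τ₁ := 1 + (N * (1 + 3) + 2)) ?_ (by lia)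
  refine seq (store (by simpa [Expr.eval] using hb 0 N.zero_le) rfl) ?_
  rintro _ - rfl
  have hagree : ∀ m', AgreeOff [i, arr] (m.write arr 0 1) m' → AgreeOff [i, arr] m m' :=
    fun m' h => (agreeOff_write m arr 0 1).trans h (by simp) (by simp)
  refine (tabulate (p := .skip) (o := 1) (fun j : Fin N => b ^ (j + 1 : ℕ)) (by simp) harri
    (by simp) (fun m' h => hbound m' (hagree m' h)) hN (fun _ _ => rfl) (fun j => hb _ j.isLt)
    fun j m' hm' hij hlow htab => skip ?_).conseq le_rfl fun m' _ ⟨hlow, htab⟩ j hj => ?_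
  · rw [Expr.eval, hbase m' (hagree m' hm'), Expr.eval, Expr.eval_var, hij, pow_succ]
    congr 1
    rcases j with ⟨_ | j, hj⟩
    · simpa [Expr.eval] using hlow 0 one_pos
    · simpa [add_comm] using htab ⟨j, Nat.lt_of_succ_lt hj⟩ (by simp [Fin.lt_def])
  · rcases j with _ | j
    · simpa [Expr.eval] using hlow 0 one_pos
    · rw [← htab ⟨j, hj⟩, add_comm]

end Runs

section InclusionExclusion

open Finset

/-- The elements that a map sends to `i`. -/
def fiber {σ ι : Type*} [Fintype σ] [DecidableEq ι] (π : σ → ι) (i : ι) : Finset σ :=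
  {s | π s = i}

@[simp]
theorem mem_fiber {σ ι : Type*} [Fintype σ] [DecidableEq ι] {π : σ → ι} {i : ι} {s : σ} :
    s ∈ fiber π i ↔ π s = i := by
  simp [fiber]

variable {σ ι R : Type*} [Fintype σ] [Fintype ι] [DecidableEq ι]

theorem sum_card_fiber (π : σ → ι) : ∑ i, (fiber π i).card = Fintype.card σ := by
  simp only [fiber, ← card_eq_sum_card_fiberwise (fun s _ => mem_univ (π s)), card_univ]

omit [Fintype ι] in
theorem fiber_injective : Function.Injective (fiber : (σ → ι) → ι → Finset σ) := by
  intro π π' h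
  funext s
  have hs : s ∈ fiber π' (π s) := congrFun h (π s) ▸ mem_fiber.2 rfl
  exact (mem_fiber.1 hs).symm

theorem exists_fiber_eq_of_cover (V : ι → Finset σ) (hV : ∀ s, ∃ i, s ∈ V i)
    (hcard : ∑ i, (V i).card ≤ Fintype.card σ) : ∃ π : σ → ι, fiber π = V := by
  choose π hπ using hV
  have hsub : ∀ i, fiber π i ⊆ V i := fun i s hs => mem_fiber.1 hs ▸ hπ s
  have hcard_le : ∀ i ∈ univ, (fiber π i).card ≤ (V i).card := fun i _ => card_le_card (hsub i)
  have hsum := le_antisymm (sum_le_sum hcard_le) (hcard.trans (sum_card_fiber π).ge)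
  have hcard_eq := (sum_eq_sum_iff_of_le hcard_le).1 hsum
  exact ⟨π, funext fun i => eq_of_subset_of_card_le (hsub i) (hcard_eq i (mem_univ i)).ge⟩

variable [DecidableEq σ] [CommRing R]

theorem sum_superset_neg_one_pow_card (T : Finset σ) :
    ∑ X : Finset σ with T ⊆ X, (-1 : R) ^ X.card
      = if T = univ then (-1) ^ Fintype.card σ else 0 := by
  have hcompl : ∑ X : Finset σ with T ⊆ X, (-1 : R) ^ X.card
      = (-1) ^ Fintype.card σ * ∑ Y ∈ Tᶜ.powerset, (-1 : R) ^ Y.card := by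
    rw [mul_sum]
    refine sum_bij' (fun X _ => Xᶜ) (fun Y _ => Yᶜ) (by simp)
      (fun Y hY => by simpa using subset_compl_comm.1 (mem_powerset.1 hY)) (by simp) (by simp) ?_
    intro X _
    rw [← card_add_card_compl X, pow_add, mul_assoc, ← mul_pow]
    simp
  have hpowerset := congrArg (Int.cast : ℤ → R) (sum_powerset_neg_one_pow_card (x := Tᶜ))
  push_cast at hpowerset
  rw [hcompl, hpowerset]
  simp [compl_eq_empty_iff]

open Classical in
theorem sum_superset_mul_pow_card (b : R) (hb : b ^ (Fintype.card σ + 1) = 0)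
    (V : ι → Finset σ) :
    (∑ X : Finset σ with univ.biUnion V ⊆ X, (-1 : R) ^ X.card) * b ^ ∑ i, (V i).card
      = if ∃ π : σ → ι, fiber π = V then (-1) ^ Fintype.card σ * b ^ Fintype.card σ else 0 := by
  rw [sum_superset_neg_one_pow_card]
  split_ifs with hcover hfiber hfiber
  · obtain ⟨π, rfl⟩ := hfiber
    rw [sum_card_fiber]
  · have hlt : Fintype.card σ < ∑ i, (V i).card := by
      refine not_le.1 fun hle => hfiber (exists_fiber_eq_of_cover V (fun s => ?_) hle)
      have hs : s ∈ univ.biUnion V := hcover ▸ mem_univ s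
      simpa using hs
    rw [pow_eq_zero_of_le hlt hb, mul_zero]
  · obtain ⟨π, rfl⟩ := hfiber
    exact absurd (eq_univ_of_forall fun s => by simp) hcover
  · exact zero_mul _

open Classical in
theorem prod_sum_powerset_pow_card (F : ι → Finset σ → Prop) (b : R) (X : Finset σ) :
    ∏ i, ∑ V ∈ X.powerset with F i V, b ^ V.card
      = ∑ V : ι → Finset σ with ∀ i, F i (V i),
          if univ.biUnion V ⊆ X then b ^ ∑ i, (V i).card else 0 := by
  rw [prod_univ_sum, ← sum_filter, filter_filter]
  refine sum_congr ?_ fun V _ => prod_pow_eq_pow_sum _ _ _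
  ext V
  simp [Fintype.mem_piFinset, forall_and, and_comm]

open Classical in
theorem sum_neg_one_pow_mul_prod (F : ι → Finset σ → Prop) (b : R)
    (hb : b ^ (Fintype.card σ + 1) = 0) :
    ∑ X : Finset σ, (-1) ^ X.card * ∏ i, ∑ V ∈ X.powerset with F i V, b ^ V.card
      = (-1) ^ Fintype.card σ * b ^ Fintype.card σ *
        (univ.filter fun π : σ → ι => ∀ i, F i (fiber π i)).card := by
  calc _ = ∑ V : ι → Finset σ with ∀ i, F i (V i),
          (∑ X : Finset σ with univ.biUnion V ⊆ X, (-1 : R) ^ X.card)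
            * b ^ ∑ i, (V i).card := by
        simp_rw [prod_sum_powerset_pow_card F b, mul_sum]
        rw [sum_comm]
        simp_rw [sum_mul, sum_filter, mul_ite, mul_zero]
    _ = (-1) ^ Fintype.card σ * b ^ Fintype.card σ *
          ((univ.filter fun π : σ → ι => ∀ i, F i (fiber π i)).image fiber).card := by
        simp only [sum_superset_mul_pow_card b hb, ← sum_filter, sum_const, nsmul_eq_mul, mul_comm]
        congr 3
        ext V
        simp only [mem_filter, mem_univ, true_and, mem_image]
        exact ⟨fun ⟨hF, π, hπ⟩ => ⟨π, hπ ▸ hF, hπ⟩, fun ⟨π, hF, hπ⟩ => ⟨hπ ▸ hF, π, hπ⟩⟩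
    _ = _ := by rw [card_image_of_injective _ fiber_injective]

open Classical in
omit [DecidableEq σ] in
theorem sum_neg_one_pow_mul_prod_ne_zero_iff (F : ι → Finset σ → Prop) {B M : ℕ}
    (hB : Fintype.card ι ^ Fintype.card σ < B) (hM : M = B ^ (Fintype.card σ + 1)) :
    (∑ X : Finset σ, (-1) ^ X.card * ∏ i, ∑ V ∈ X.powerset with F i V, (B : ZMod M) ^ V.card) ≠ 0
      ↔ ∃ π : σ → ι, ∀ i, F i (fiber π i) := by
  subst hM
  rw [sum_neg_one_pow_mul_prod F _ (by rw [← Nat.cast_pow, ZMod.natCast_self])]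
  set P := univ.filter fun π : σ → ι => ∀ i, F i (fiber π i) with hP
  have hlt : P.card < B := (card_le_univ P).trans_lt (by rwa [Fintype.card_fun])
  have hunit : IsUnit ((-1 : ZMod (B ^ (Fintype.card σ + 1))) ^ Fintype.card σ) :=
    isUnit_one.neg.pow _
  have hne : (∃ π : σ → ι, ∀ i, F i (fiber π i)) ↔ P.card ≠ 0 := by
    simp [hP, filter_eq_empty_iff]
  rw [hne, mul_assoc, Ne, hunit.mul_right_eq_zero, ← Nat.cast_pow, ← Nat.cast_mul,
    ZMod.natCast_eq_zero_iff, pow_succ, Nat.mul_dvd_mul_iff_left (pow_pos (by lia) _)]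
  exact not_congr ⟨fun h => Nat.eq_zero_of_dvd_of_lt h hlt, fun h => h ▸ dvd_zero _⟩

end InclusionExclusion

section SubsetSums

variable {K : ℕ} {R : Type*} [AddCommMonoid R]

/-- The sums of `f` over the sets between `V` and `V` without its elements below `r`. -/
def subsetSum (f : Finset (Fin K) → R) (r : ℕ) (V : Finset (Fin K)) : R :=
  ∑ T ∈ (V.filter fun s : Fin K => (s : ℕ) < r).powerset, f (V \ T)

@[simp]
theorem subsetSum_zero (f : Finset (Fin K) → R) (V : Finset (Fin K)) : subsetSum f 0 V = f V := by
  simp [subsetSum]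

theorem subsetSum_succ (f : Finset (Fin K) → R) (r : Fin K) (V : Finset (Fin K)) :
    subsetSum f (r + 1) V
      = subsetSum f r V + if r ∈ V then subsetSum f r (V.erase r) else 0 := by
  split_ifs with hr
  · have hinsert : (V.filter fun s : Fin K => (s : ℕ) < r + 1)
        = insert r (V.filter fun s : Fin K => (s : ℕ) < r) := by
      ext s
      simp only [Finset.mem_filter, Finset.mem_insert, Fin.ext_iff]
      grind
    have herase : ((V.erase r).filter fun s : Fin K => (s : ℕ) < r)
        = V.filter fun s : Fin K => (s : ℕ) < r := by
      ext s
      simp only [Finset.mem_filter, Finset.mem_erase, ne_eq, Fin.ext_iff]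
      grind
    rw [subsetSum, hinsert, Finset.sum_powerset_insert (by simp), subsetSum, subsetSum, herase]
    simp only [Finset.sdiff_insert, Finset.erase_sdiff_comm]
  · have hfilter : (V.filter fun s : Fin K => (s : ℕ) < r + 1)
        = V.filter fun s : Fin K => (s : ℕ) < r := by
      ext s
      simp only [Finset.mem_filter]
      grind
    rw [subsetSum, hfilter, add_zero, subsetSum]

theorem subsetSum_top (f : Finset (Fin K) → R) (V : Finset (Fin K)) :
    subsetSum f K V = ∑ T ∈ V.powerset, f T := by
  rw [subsetSum, Finset.filter_true_of_mem fun s _ => s.isLt]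
  refine Finset.sum_bij' (fun T _ => V \ T) (fun T _ => V \ T) ?_ ?_ ?_ ?_ fun _ _ => rfl <;>
    simp +contextual

end SubsetSums

section Code

/-- Sets of numbers below `K` are coded by numbers with `K` binary digits. -/
noncomputable def code (K : ℕ) : Finset (Fin K) ≃ Fin (2 ^ K) :=
  Equiv.trans
    { toFun := fun V s => if s ∈ V then (1 : Fin 2) else 0
      invFun := fun f => Finset.univ.filter fun s => f s = 1
      left_inv := fun V => by ext s; simp
      right_inv := fun f => by funext s; simp only [Finset.mem_filter_univ]; lia }
    finFunctionFinEquiv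

variable {K : ℕ}

theorem code_eq_sum (V : Finset (Fin K)) : (code K V : ℕ) = ∑ s, bit (s ∈ V) * 2 ^ (s : ℕ) := by
  rw [code, Equiv.trans_apply, finFunctionFinEquiv_apply]
  refine Finset.sum_congr rfl fun s _ => ?_
  by_cases h : s ∈ V <;> simp [bit, h]

theorem code_div_two_pow_mod_two (V : Finset (Fin K)) (s : Fin K) :
    (code K V : ℕ) / 2 ^ (s : ℕ) % 2 = bit (s ∈ V) := by
  rw [code, Equiv.trans_apply, ← finFunctionFinEquiv_symm_apply_val, Equiv.symm_apply_apply]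
  by_cases h : s ∈ V <;> simp [bit, h]

theorem code_erase {V : Finset (Fin K)} {r : Fin K} (hr : r ∈ V) :
    (code K (V.erase r) : ℕ) = code K V - 2 ^ (r : ℕ) := by
  have hsplit : ∀ W : Finset (Fin K), (code K W : ℕ) = ∑ s ∈ W, 2 ^ (s : ℕ) := fun W => by
    simp [code_eq_sum, bit, Finset.sum_ite_mem]
  rw [hsplit, hsplit, ← Finset.sum_erase_add _ _ hr, Nat.add_sub_cancel]

end Code

section Constraints

variable {S U : Type}

theorem satisfied_iff_of_eq {γ : EntailmentConstraint S U} (h : γ.rel = Eq) (π : S → U) :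
    γ.Satisfied π ↔ ∃ s ∈ γ.left, ∃ t ∈ γ.right, π s = π t := by
  simp [EntailmentConstraint.Satisfied, h]

theorem satisfied_of_not_disjoint {γ : EntailmentConstraint S U} (hrel : γ.rel = Eq)
    (h : ¬ Disjoint γ.left γ.right) (π : S → U) : γ.Satisfied π :=
  have ⟨s, hs, hs'⟩ := Finset.not_disjoint_iff.1 h
  (satisfied_iff_of_eq hrel π).2 ⟨s, hs, s, hs', rfl⟩

section Side

variable [DecidableEq S]

/-- The pair of sets of a constraint as a map to `{0, 1, 2}`: `1` on the left set, `2` on the rest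
of the right set, and `0` elsewhere. -/
def EntailmentConstraint.side (γ : EntailmentConstraint S U) (s : S) : Fin 3 :=
  if s ∈ γ.left then 1 else if s ∈ γ.right then 2 else 0

theorem side_eq_one {γ : EntailmentConstraint S U} {s : S} : γ.side s = 1 ↔ s ∈ γ.left := by
  unfold EntailmentConstraint.side
  split_ifs <;> simp [*]

theorem side_eq_two {γ : EntailmentConstraint S U} (h : Disjoint γ.left γ.right) {s : S} :
    γ.side s = 2 ↔ s ∈ γ.right := by
  have hs : s ∈ γ.left → s ∉ γ.right := fun hs => Finset.disjoint_left.1 h hs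
  unfold EntailmentConstraint.side
  split_ifs <;> simp_all

theorem injOn_side : Set.InjOn (EntailmentConstraint.side (S := S) (U := U))
    {γ | γ.rel = Eq ∧ Disjoint γ.left γ.right} := by
  rintro γ ⟨hrel, hdisj⟩ γ' ⟨hrel', hdisj'⟩ h
  have hleft : γ.left = γ'.left := by
    ext s
    rw [← side_eq_one, ← side_eq_one, h]
  have hright : γ.right = γ'.right := by
    ext s
    rw [← side_eq_two hdisj, ← side_eq_two hdisj', h]
  cases γ
  cases γ'
  simp_all

end Side

theorem exists_sublist_constraints [Fintype S] (W : Schema S U)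
    (hW : ∀ γ ∈ W.constraints, γ.rel = Eq) :
    ∃ C : List (EntailmentConstraint S U), C.Sublist W.constraints ∧
      C.length ≤ 3 ^ Fintype.card S ∧ ∀ π : S → U, W.Valid π ↔ (W.withConstraints C).Valid π := by
  classical
  set C := (W.constraints.filter fun γ => Disjoint γ.left γ.right).dedup with hC
  have hsub : C.Sublist W.constraints := (List.dedup_sublist _).trans List.filter_sublist
  have hmem : ∀ γ, γ ∈ C ↔ γ ∈ W.constraints ∧ Disjoint γ.left γ.right := fun γ => by simp [hC]
  refine ⟨C, hsub, ?_, fun π => and_congr_right fun _ =>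
    ⟨fun h γ hγ => h γ (hsub.subset hγ), fun h γ hγ => ?_⟩⟩
  · have hinj : Set.InjOn EntailmentConstraint.side (C.toFinset : Set (EntailmentConstraint S U)) :=
      injOn_side.mono fun γ hγ => by
        have hγ' := (hmem γ).1 (by simpa using hγ)
        exact ⟨hW γ hγ'.1, hγ'.2⟩
    calc C.length = C.toFinset.card := (List.toFinset_card_of_nodup (List.nodup_dedup _)).symm
      _ ≤ Fintype.card (S → Fin 3) := Finset.card_le_card_of_injOn _ (by simp) hinj
      _ = 3 ^ Fintype.card S := by simp
  · by_cases hdisj : Disjoint γ.left γ.right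
    · exact h γ ((hmem γ).2 ⟨hγ, hdisj⟩)
    · exact satisfied_of_not_disjoint (hW γ hγ) hdisj π

section BlockCriterion

variable {σ : Type} [Fintype σ] [DecidableEq U]

/-- The steps are embedded by `e` in a possibly larger set `σ`, and `viol V g` says that the set `V`
of all elements assigned to some user excludes that the `g`-th constraint is satisfied. The plans
that satisfy all constraints have to be the restrictions of the assignments of the elements of `σ`
to users none of whose blocks `V` is excluded. -/
structure BlockCriterion (W : Schema S U) (e : S → σ)
    (viol : Finset σ → Fin W.constraints.length → Prop) : Prop where
  sound : ∀ φ : σ → U, (∀ u g, ¬ viol (fiber φ u) g) → ∀ γ ∈ W.constraints, γ.Satisfied (φ ∘ e)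
  complete : ∀ π : S → U, (∀ γ ∈ W.constraints, γ.Satisfied π) →
    ∃ φ : σ → U, φ ∘ e = π ∧ ∀ u g, ¬ viol (fiber φ u) g

/-- Some step of a set of steps belongs to `V`. -/
def Meets (e : S → σ) (V : Finset σ) (A : Finset S) : Prop := ∃ s ∈ A, e s ∈ V

/-- In a Type 2 constraint one of the sets is a singleton, and the user of its step has to perform
a step of the other set as well. -/
def Type2Violated (V : Finset S) (γ : EntailmentConstraint S U) : Prop :=
  (γ.left.card = 1 ∧ Meets id V γ.left ∧ ¬ Meets id V γ.right) ∨
    (γ.left.card ≠ 1 ∧ Meets id V γ.right ∧ ¬ Meets id V γ.left)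

theorem forall_not_singleton_meets_iff [Fintype S] {A B : Finset S}
    (hA : A.card = 1) (π : S → U) :
    (∀ u, ¬ (Meets id (fiber π u) A ∧ ¬ Meets id (fiber π u) B))
      ↔ ∃ s ∈ A, ∃ t ∈ B, π s = π t := by
  obtain ⟨a, rfl⟩ := Finset.card_eq_one.1 hA
  simp [Meets, eq_comm]

theorem forall_not_type2Violated_iff [Fintype S] {γ : EntailmentConstraint S U}
    (hrel : γ.rel = Eq) (htype : γ.IsType2) (π : S → U) :
    (∀ u, ¬ Type2Violated (fiber π u) γ) ↔ γ.Satisfied π := by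
  rw [satisfied_iff_of_eq hrel]
  by_cases hleft : γ.left.card = 1
  · rw [← forall_not_singleton_meets_iff hleft]
    simp [Type2Violated, hleft]
  · have hright := htype.resolve_left hleft
    have hswap : (∃ s ∈ γ.left, ∃ t ∈ γ.right, π s = π t)
        ↔ ∃ t ∈ γ.right, ∃ s ∈ γ.left, π t = π s :=
      ⟨fun ⟨s, hs, t, ht, h⟩ => ⟨t, ht, s, hs, h.symm⟩,
        fun ⟨t, ht, s, hs, h⟩ => ⟨s, hs, t, ht, h.symm⟩⟩
    rw [hswap, ← forall_not_singleton_meets_iff hright]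
    simp [Type2Violated, hleft]

theorem blockCriterion_type2 [Fintype S] (W : Schema S U) (hrel : ∀ γ ∈ W.constraints, γ.rel = Eq)
    (htype : ∀ γ ∈ W.constraints, γ.IsType2) :
    BlockCriterion W id fun V g => Type2Violated V (W.constraints.get g) where
  sound φ h := by
    rw [List.forall_mem_iff_get]
    exact fun g => (forall_not_type2Violated_iff (hrel _ (List.get_mem _ g))
      (htype _ (List.get_mem _ g)) φ).1 fun u => h u g
  complete π h := ⟨π, rfl, fun u g => (forall_not_type2Violated_iff (hrel _ (List.get_mem _ g))
      (htype _ (List.get_mem _ g)) π).2 (h _ (List.get_mem _ g)) u⟩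

/-- The constraint `γ` has been given an element `x`, which is assigned to a user who performs a
step of either set of `γ`. -/
def WitnessViolated (e : S → σ) (x : σ) (V : Finset σ) (γ : EntailmentConstraint S U) : Prop :=
  x ∈ V ∧ ¬ (Meets e V γ.left ∧ Meets e V γ.right)

theorem blockCriterion_witness (W : Schema S U) (hrel : ∀ γ ∈ W.constraints, γ.rel = Eq)
    {e : S → σ} (he : Function.Injective e) (elt : Fin W.constraints.length → σ)
    (helt : ∀ g g', elt g = elt g' → W.constraints.get g = W.constraints.get g')
    (hdisj : ∀ g s, e s ≠ elt g)
    (hextra : ∀ x, (x ∈ Set.range e ∨ x ∈ Set.range elt) ∨ Nonempty U) :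
    BlockCriterion W e fun V g => WitnessViolated e (elt g) V (W.constraints.get g) where
  sound φ h := by
    rw [List.forall_mem_iff_get]
    intro g
    have hg := h (φ (elt g)) g
    simp only [WitnessViolated, mem_fiber, true_and, not_not, Meets] at hg
    obtain ⟨⟨s, hs, hsu⟩, t, ht, htu⟩ := hg
    exact (satisfied_iff_of_eq (hrel _ (List.get_mem _ g)) _).2 ⟨s, hs, t, ht, hsu.trans htu.symm⟩
  complete π h := by
    have hwitness : ∀ g, ∃ u, (∃ s ∈ (W.constraints.get g).left, π s = u) ∧
        ∃ t ∈ (W.constraints.get g).right, π t = u := fun g => by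
      have hγ := List.get_mem W.constraints g
      obtain ⟨s, hs, t, ht, hst⟩ := (satisfied_iff_of_eq (hrel _ hγ) π).1 (h _ hγ)
      exact ⟨π s, ⟨s, hs, rfl⟩, t, ht, hst.symm⟩
    have huser : ∀ x, ∃ u, (∀ s, e s = x → π s = u) ∧ ∀ g, elt g = x →
        (∃ s ∈ (W.constraints.get g).left, π s = u) ∧
          ∃ t ∈ (W.constraints.get g).right, π t = u := by
      intro x
      by_cases hstep : x ∈ Set.range e
      · obtain ⟨s, rfl⟩ := hstep
        exact ⟨π s, fun t ht => by rw [he ht], fun g hg => absurd hg.symm (hdisj g s)⟩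
      · by_cases hx : x ∈ Set.range elt
        · obtain ⟨g, rfl⟩ := hx
          obtain ⟨u, hu⟩ := hwitness g
          exact ⟨u, fun s hs => absurd hs (hdisj g s), fun g' hg' => helt g' g hg' ▸ hu⟩
        · obtain ⟨u⟩ := (hextra x).resolve_left (by tauto)
          exact ⟨u, fun s hs => absurd ⟨s, hs⟩ hstep, fun g hg => absurd ⟨g, hg⟩ hx⟩
    choose φ hφ hφ' using huser
    refine ⟨φ, funext fun s => (hφ _ s rfl).symm, ?_⟩
    rintro _ g ⟨hu, hviol⟩
    obtain ⟨⟨s, hs, hsu⟩, t, ht, htu⟩ := hφ' (elt g) g rfl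
    rw [mem_fiber] at hu
    exact hviol ⟨⟨s, hs, mem_fiber.2 (by rw [← hφ _ s rfl, hsu, hu])⟩,
      t, ht, mem_fiber.2 (by rw [← hφ _ t rfl, htu, hu])⟩

end BlockCriterion

section PairCode

variable {k : ℕ}

/-- The two sets of a constraint as a number with `k` digits in base `4`. -/
noncomputable def pairCode (γ : EntailmentConstraint (Fin k) U) : Fin (4 ^ k) :=
  finFunctionFinEquiv fun s => ⟨bit (s ∈ γ.left) + 2 * bit (s ∈ γ.right), by
    have hleft := bit_le_one (s ∈ γ.left)
    have hright := bit_le_one (s ∈ γ.right)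
    lia⟩

theorem pairCode_val (γ : EntailmentConstraint (Fin k) U) :
    (pairCode γ : ℕ) = ∑ s, (bit (s ∈ γ.left) + 2 * bit (s ∈ γ.right)) * 4 ^ (s : ℕ) :=
  finFunctionFinEquiv_apply _

theorem injOn_pairCode : Set.InjOn (pairCode (k := k) (U := U)) {γ | γ.rel = Eq} := by
  intro γ hγ γ' hγ' h
  have hdigit : ∀ s, bit (s ∈ γ.left) + 2 * bit (s ∈ γ.right)
      = bit (s ∈ γ'.left) + 2 * bit (s ∈ γ'.right) := fun s =>
    congrArg Fin.val (congrFun (finFunctionFinEquiv.injective h) s)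
  have hmem : ∀ s, (s ∈ γ.left ↔ s ∈ γ'.left) ∧ (s ∈ γ.right ↔ s ∈ γ'.right) := fun s => by
    have hs := hdigit s
    unfold bit at hs
    split_ifs at hs <;> lia
  have hleft : γ.left = γ'.left := Finset.ext fun s => (hmem s).1
  have hright : γ.right = γ'.right := Finset.ext fun s => (hmem s).2
  have hrel : γ.rel = γ'.rel := Eq.trans hγ (Eq.symm hγ')
  cases γ
  cases γ'
  simp_all

end PairCode

end Constraints

section Input

theorem length_flatMap_of_length {α β : Type*} {l : List α} {f : α → List β} {w : ℕ}
    (hw : ∀ a ∈ l, (f a).length = w) : (l.flatMap f).length = l.length * w := by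
  rw [List.length_flatMap, List.map_congr_left hw]
  simp

theorem getD_flatMap_of_length {α β : Type*} {l : List α} {f : α → List β} {w : ℕ}
    (hw : ∀ a ∈ l, (f a).length = w) (d : β) (i : Fin l.length) {j : ℕ} (hj : j < w) :
    (l.flatMap f).getD (i * w + j) d = (f (l.get i)).getD j d := by
  induction l with
  | nil => exact i.elim0
  | cons a l ih =>
    obtain ⟨ha, hl⟩ := List.forall_mem_cons.1 hw
    rw [List.flatMap_cons]
    cases i using Fin.cases with
    | zero =>
      rw [List.getD_append _ _ _ _ (by simp [ha, hj])]
      simp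
    | succ i =>
      have hidx : (i.succ : ℕ) * w + j = w + (i * w + j) := by rw [Fin.val_succ]; ring
      rw [hidx, List.getD_append_right _ _ _ _ (ha ▸ Nat.le_add_right _ _), ha,
        Nat.add_sub_cancel_left, ih hl i]
      simp

/-- Array `0` of the memory holds the sizes and the tables of the workflow schema `W`. -/
structure Input {k n : ℕ} (W : Schema (Fin k) (Fin n)) (m : Memory) : Prop where
  steps : m 0 0 = k
  users : m 0 1 = n
  constraints : m 0 2 = W.constraints.length
  auth : ∀ (s : Fin k) (u : Fin n), m 0 (3 + k * k + (s * n + u)) = bit (W.auth s u)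
  left : ∀ (g : Fin W.constraints.length) (s : Fin k),
    m 0 (3 + k * k + k * n + (g * (2 * k) + s)) = bit (s ∈ (W.constraints.get g).left)
  right : ∀ (g : Fin W.constraints.length) (s : Fin k),
    m 0 (3 + k * k + k * n + (g * (2 * k) + (k + s))) = bit (s ∈ (W.constraints.get g).right)

theorem Input.of_agreeOff {k n : ℕ} {W : Schema (Fin k) (Fin n)} {m m' : Memory} {w : List ℕ}
    (h : Input W m) (hw : AgreeOff w m m') (h0 : 0 ∉ w) : Input W m' := by
  have h0 := hw 0 h0
  constructor <;> rw [h0]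
  exacts [h.steps, h.users, h.constraints, h.auth, h.left, h.right]

namespace Instance

variable (I : Instance)

/-- The table of the order in the encoding of an instance. -/
noncomputable def orderTable : List ℕ :=
  (List.finRange I.k).flatMap fun s =>
    (List.finRange I.k).map fun t => bit (I.schema.order.le s t)

/-- The table of the authorization relation in the encoding of an instance. -/
noncomputable def authTable : List ℕ :=
  (List.finRange I.k).flatMap fun s => (List.finRange I.n).map fun u => bit (I.schema.auth s u)

/-- The table of the constraints in the encoding of an instance. -/
noncomputable def constraintTable : List ℕ :=
  I.schema.constraints.flatMap fun γ =>
    (List.finRange I.k).map (fun s => bit (s ∈ γ.left))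
      ++ (List.finRange I.k).map (fun s => bit (s ∈ γ.right))

theorem encode_eq :
    I.encode = [I.k, I.n, I.c] ++ I.orderTable ++ I.authTable ++ I.constraintTable := rfl

theorem length_orderTable : I.orderTable.length = I.k * I.k :=
  (length_flatMap_of_length (w := I.k) (by simp)).trans (by simp)

theorem length_authTable : I.authTable.length = I.k * I.n :=
  (length_flatMap_of_length (w := I.n) (by simp)).trans (by simp)

theorem length_constraintTable : I.constraintTable.length = I.c * (2 * I.k) :=
  length_flatMap_of_length fun γ _ => by simp [two_mul]

theorem encode_getD_auth {j : ℕ} (hj : j < I.k * I.n) :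
    I.encode.getD (3 + I.k * I.k + j) 0 = I.authTable.getD j 0 := by
  have hlen : ([I.k, I.n, I.c] ++ I.orderTable).length = 3 + I.k * I.k := by
    simp only [List.length_append, length_orderTable, List.length_cons, List.length_nil]
  rw [encode_eq, List.getD_append _ _ _ _ (by rw [List.length_append, hlen, length_authTable]; lia),
    List.getD_append_right _ _ _ _ (by lia), hlen, Nat.add_sub_cancel_left]

theorem encode_getD_constraint (j : ℕ) :
    I.encode.getD (3 + I.k * I.k + I.k * I.n + j) 0 = I.constraintTable.getD j 0 := by
  have hlen : ([I.k, I.n, I.c] ++ I.orderTable ++ I.authTable).length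
      = 3 + I.k * I.k + I.k * I.n := by
    simp only [List.length_append, length_orderTable, length_authTable, List.length_cons,
      List.length_nil]
  rw [encode_eq, List.getD_append_right _ _ _ _ (by lia), hlen, Nat.add_sub_cancel_left]

theorem constraintTable_getD (g : Fin I.c) {j : ℕ} (hj : j < 2 * I.k) :
    I.constraintTable.getD (g * (2 * I.k) + j) 0
      = ((List.finRange I.k).map (fun s => bit (s ∈ (I.schema.constraints.get g).left))
          ++ (List.finRange I.k).map
            fun s => bit (s ∈ (I.schema.constraints.get g).right)).getD j 0 :=
  getD_flatMap_of_length (fun γ _ => by simp [two_mul]) 0 g hj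

theorem input_initial : Input I.schema I.initial where
  steps := rfl
  users := rfl
  constraints := rfl
  auth s u := by
    have hlt : (s : ℕ) * I.n + u < I.k * I.n := by nlinarith [s.2, u.2]
    rw [initial, if_pos rfl, I.encode_getD_auth hlt]
    refine (getD_flatMap_of_length (by simp) 0 (Fin.cast (by simp) s) u.isLt).trans ?_
    simp
  left g s := by
    rw [initial, if_pos rfl, encode_getD_constraint, I.constraintTable_getD g (by lia),
      List.getD_append _ _ _ _ (by simp)]
    simp
  right g s := by
    rw [initial, if_pos rfl, encode_getD_constraint, I.constraintTable_getD g (by lia),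
      List.getD_append_right _ _ _ _ (by simp)]
    simp

theorem le_of_mem_encode {v : ℕ} (hv : v ∈ I.encode) : v ≤ I.k + I.n + I.c + 1 := by
  have hbit : ∀ p, bit p ≤ I.k + I.n + I.c + 1 := fun p => (bit_le_one p).trans (by lia)
  simp only [encode, List.mem_append, List.mem_cons, List.not_mem_nil, or_false, List.mem_flatMap,
    List.mem_map] at hv
  rcases hv with (((rfl | rfl | rfl) | ⟨_, _, _, _, rfl⟩) | ⟨_, _, _, _, rfl⟩)
    | ⟨_, _, ⟨_, _, rfl⟩ | ⟨_, _, rfl⟩⟩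
  all_goals first | lia | exact hbit _

theorem bounded_initial {L : ℕ} (h : I.k + I.n + I.c + 1 < 2 ^ L) : I.initial.Bounded L := by
  intro a i
  refine lt_of_le_of_lt ?_ h
  unfold initial
  split_ifs
  · rcases lt_or_ge i I.encode.length with hi | hi
    · rw [List.getD_eq_getElem _ _ hi]
      exact I.le_of_mem_encode (List.getElem_mem hi)
    · rw [List.getD_eq_default _ _ hi]
      exact Nat.zero_le _
  · exact Nat.zero_le _

end Instance

end Input

section Solver

open Program

/-! ### The solver -/

-- Arrays: input, output, powers of `2`, powers of `n + 2`, subset sums.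
local notation "aIn" => 0
local notation "aOut" => 1
local notation "aTwo" => 2
local notation "aUser" => 3
local notation "aSub" => 4

-- Registers that are constant after the preparation: the size of the ground set, and the modulus.
local notation "rSize" => 5
local notation "rMod" => 6

-- Loop counters: elements, constraints, sets of elements, rows of `aSub`, users; then the step and
-- its user in the search for a plan.
local notation "rElem" => 7
local notation "rCon" => 8
local notation "rSet" => 9
local notation "rRow" => 10
local notation "rUser" => 11
local notation "rStep" => 12
local notation "rChoice" => 13

-- Results of sums and products, and the number of steps whose users are fixed.
local notation "rLeft" => 14
local notation "rRight" => 15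
local notation "rSingle" => 16
local notation "rPair" => 17
local notation "rViol" => 18
local notation "rCard" => 19
local notation "rAllowed" => 20
local notation "rProd" => 21
local notation "rTotal" => 22
local notation "rFixed" => 23

section Preparation

/-- The base of the weights of the blocks: it exceeds the number of maps from a set of `K` elements
to `n` users. -/
def weightBase (n K : ℕ) : ℕ := (n + 2) ^ (K + 1)

/-- The solver computes modulo the power of the base that exceeds the weight of every set. -/
def modulus (n K : ℕ) : ℕ := weightBase n K ^ (K + 1)

theorem modulus_eq (n K : ℕ) : modulus n K = (n + 2) ^ ((K + 1) * (K + 1)) := (pow_mul _ _ _).symm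

theorem pow_lt_weightBase (n K : ℕ) : n ^ K < weightBase n K :=
  calc n ^ K ≤ (n + 2) ^ K := Nat.pow_le_pow_left (by lia) _
    _ < (n + 2) ^ (K + 1) := Nat.pow_lt_pow_right (by lia) K.lt_succ_self

theorem pow_lt_modulus {n K j : ℕ} (hj : j ≤ K) : weightBase n K ^ j < modulus n K :=
  Nat.pow_lt_pow_right (Nat.one_lt_pow (by lia) (by lia)) (Nat.lt_succ_of_le hj)

theorem one_lt_modulus (n K : ℕ) : 1 < modulus n K := by
  simpa using pow_lt_modulus (n := n) K.zero_le

/-- Words of `L` bits are long enough to treat `c` constraints on a ground set of size `K`. -/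
structure WordSize (n c K L : ℕ) : Prop where
  modulus_lt : 2 ^ K * modulus n K < 2 ^ L
  constraints_lt : c < 2 ^ L

namespace WordSize

variable {n c K L : ℕ}

theorem pow_lt (h : WordSize n c K L) {j : ℕ} (hj : j ≤ (K + 1) * (K + 1)) : (n + 2) ^ j < 2 ^ L :=
  calc (n + 2) ^ j ≤ (n + 2) ^ ((K + 1) * (K + 1)) := Nat.pow_le_pow_right (by lia) hj
    _ = modulus n K := (modulus_eq n K).symm
    _ ≤ 2 ^ K * modulus n K := Nat.le_mul_of_pos_left _ (by positivity)
    _ < 2 ^ L := h.modulus_lt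

theorem two_pow_lt (h : WordSize n c K L) {j : ℕ} (hj : j ≤ (K + 1) * (K + 1)) : 2 ^ j < 2 ^ L :=
  (Nat.pow_le_pow_left (by lia) j).trans_lt (h.pow_lt hj)

theorem lt (h : WordSize n c K L) {j : ℕ} (hj : j ≤ (K + 1) * (K + 1)) : j < 2 ^ L :=
  Nat.lt_two_pow_self.trans (h.two_pow_lt hj)

theorem users_lt (h : WordSize n c K L) : n < 2 ^ L := by
  have hbase := h.pow_lt (j := 1) (by lia)
  lia

theorem modulus_lt_two_pow (h : WordSize n c K L) : modulus n K < 2 ^ L :=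
  modulus_eq n K ▸ h.pow_lt le_rfl

end WordSize

/-- The number of steps in the input. -/
def numSteps : Expr := .load aIn (.lit 0)

/-- The number of users in the input. -/
def numUsers : Expr := .load aIn (.lit 1)

/-- The number of constraints in the input. -/
def numConstraints : Expr := .load aIn (.lit 2)

/-- The entry of the authorization relation for step `s` and user `u`. -/
def authBit (s u : Expr) : Expr :=
  .load aIn (.add (.add (.lit 3) (.mul numSteps numSteps)) (.add (.mul s numUsers) u))

/-- The membership of step `s` in the first set of constraint `g`. -/
def leftBit (g s : Expr) : Expr :=
  .load aIn (.add (.add (.add (.lit 3) (.mul numSteps numSteps)) (.mul numSteps numUsers))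
    (.add (.mul g (.mul (.lit 2) numSteps)) s))

/-- The membership of step `s` in the second set of constraint `g`. -/
def rightBit (g s : Expr) : Expr := leftBit g (.add numSteps s)

/-- The membership of element `x` in the set of elements coded by register `rSet`. -/
def memBit (x : Expr) : Expr := .mod (.div (.var rSet) (.load aTwo x)) (.lit 2)

/-- The memory after the preparation: the input, the size `K` of the ground set, the powers of `2`
and `n + 2`, and the modulus. -/
structure Prepared {k n : ℕ} (W : Schema (Fin k) (Fin n)) (K : ℕ) (m : Memory) : Prop
    extends Input W m where
  size : m rSize 0 = K
  two : ∀ j ≤ K, m aTwo j = 2 ^ j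
  user : ∀ j ≤ (K + 1) * (K + 1), m aUser j = (n + 2) ^ j
  mod : m rMod 0 = modulus n K

/-- Registers and arrays on which `Prepared` depends. -/
def preparedCells : List ℕ := [aIn, aTwo, aUser, rSize, rMod]

variable {k n K L : ℕ} {W : Schema (Fin k) (Fin n)} {m m' : Memory}

namespace Input

variable (h : Input W m)
include h

theorem eval_numSteps : numSteps.eval m = k := h.steps

theorem eval_numUsers : numUsers.eval m = n := h.users

theorem eval_numConstraints : numConstraints.eval m = W.constraints.length := h.constraints

theorem eval_authBit {s u : Expr} {s' : Fin k} {u' : Fin n} (hs : s.eval m = s')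
    (hu : u.eval m = u') : (authBit s u).eval m = bit (W.auth s' u') := by
  simp only [authBit, Expr.eval, h.eval_numSteps, h.eval_numUsers, hs, hu, h.auth]

theorem eval_leftBit {g s : Expr} {g' : Fin W.constraints.length} {s' : Fin k}
    (hg : g.eval m = g') (hs : s.eval m = s') :
    (leftBit g s).eval m = bit (s' ∈ (W.constraints.get g').left) := by
  simp only [leftBit, Expr.eval, h.eval_numSteps, h.eval_numUsers, hg, hs, h.left]

theorem eval_rightBit {g s : Expr} {g' : Fin W.constraints.length} {s' : Fin k}
    (hg : g.eval m = g') (hs : s.eval m = s') :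
    (rightBit g s).eval m = bit (s' ∈ (W.constraints.get g').right) := by
  simp only [rightBit, leftBit, Expr.eval, h.eval_numSteps, h.eval_numUsers, hg, hs, h.right]

end Input

namespace Prepared

theorem of_agreeOff {w : List ℕ} (h : Prepared W K m) (hw : AgreeOff w m m')
    (hdisj : ∀ a ∈ preparedCells, a ∉ w) : Prepared W K m' where
  toInput := h.toInput.of_agreeOff hw (hdisj _ (by simp [preparedCells]))
  size := by rw [hw rSize (hdisj _ (by simp [preparedCells])), h.size]
  two := by rw [hw aTwo (hdisj _ (by simp [preparedCells]))]; exact h.two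
  user := by rw [hw aUser (hdisj _ (by simp [preparedCells]))]; exact h.user
  mod := by rw [hw rMod (hdisj _ (by simp [preparedCells])), h.mod]

theorem eval_memBit (h : Prepared W K m) {x : Expr} {x' : Fin K} {V : Finset (Fin K)}
    (hV : m rSet 0 = code K V) (hx : x.eval m = x') : (memBit x).eval m = bit (x' ∈ V) := by
  simp only [memBit, Expr.eval_mod, Expr.eval, Expr.eval_var, hV, hx, h.two _ x'.isLt.le,
    code_div_two_pow_mod_two]

end Prepared

/-- Prepares the memory for a ground set whose size is the value of `size`, an expression that may
use the powers of `2` up to the number of steps. -/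
def prepare (size : Expr) : Program :=
  powers aTwo rElem numSteps (.lit 2) ;;
  .store rSize (.lit 0) size ;;
  powers aTwo rElem (.var rSize) (.lit 2) ;;
  powers aUser rElem (.mul (.add (.var rSize) (.lit 1)) (.add (.var rSize) (.lit 1)))
    (.add numUsers (.lit 2)) ;;
  .store rMod (.lit 0)
    (.load aUser (.mul (.add (.var rSize) (.lit 1)) (.add (.var rSize) (.lit 1))))

theorem runs_prepare {size : Expr} (hL : WordSize n W.constraints.length K L) (hK : k ≤ K)
    (hsize : ∀ m', Input W m' → (∀ j ≤ k, m' aTwo j = 2 ^ j) → size.eval m' = K)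
    (hm : Input W m) :
    Runs L (prepare size) m (4 * (k + K + (K + 1) * (K + 1)) + 11) (Prepared W K) := by
  have hK_le : K ≤ (K + 1) * (K + 1) := by nlinarith
  have hinput : ∀ {m₁ m₂ : Memory} {w : List ℕ}, Input W m₁ → AgreeOff w m₁ m₂ → aIn ∉ w →
      Input W m₂ := fun h => h.of_agreeOff
  refine Runs.mono (τ₁ := (k * 4 + 3) + (1 + ((K * 4 + 3) + (((K + 1) * (K + 1) * 4 + 3) + 1))))
    ?_ (by lia)
  refine Runs.seq (Runs.powers (N := k) (b := 2) (by simp)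
    (fun m₁ h₁ => (hinput hm h₁ (by simp)).steps) (hL.lt (by lia)) (fun _ _ => rfl)
    fun j hj => hL.two_pow_lt (by lia)) fun m₁ h₁ htwo => ?_
  have hm₁ := hinput hm h₁ (by simp)
  have hsize₁ := hsize m₁ hm₁ htwo
  refine Runs.seq (Runs.store (hsize₁ ▸ hL.lt hK_le) rfl) ?_
  rintro m₂ h₂ rfl
  have hm₂ := hinput hm₁ h₂ (by simp)
  rw [hsize₁] at h₂ hm₂ ⊢
  refine Runs.seq (Runs.powers (N := K) (b := 2) (by simp)
    (fun m₃ h₃ => by rw [Expr.eval_var, h₃ rSize (by simp)]; simp [Expr.eval]) (hL.lt hK_le)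
    (fun _ _ => rfl) fun j hj => hL.two_pow_lt (by lia)) fun m₃ h₃ htwo₃ => ?_
  have hm₃ := hinput hm₂ h₃ (by simp)
  have hsize₃ : m₃ rSize 0 = K := by rw [h₃ rSize (by simp)]; simp [Expr.eval]
  have hbound : ∀ m', m' rSize 0 = K →
      (Expr.mul (.add (.var rSize) (.lit 1)) (.add (.var rSize) (.lit 1))).eval m'
        = (K + 1) * (K + 1) := fun m' h => by simp only [Expr.eval, Expr.eval_var, h]
  refine Runs.seq (Runs.powers (N := (K + 1) * (K + 1)) (b := n + 2) (by simp)
    (fun m₄ h₄ => hbound m₄ (by rw [h₄ rSize (by simp), hsize₃])) (hL.lt le_rfl)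
    (fun m₄ h₄ => by rw [Expr.eval, (hinput hm₃ h₄ (by simp)).eval_numUsers]; rfl)
    fun j hj => hL.pow_lt hj) fun m₄ h₄ huser₄ => ?_
  have hm₄ := hinput hm₃ h₄ (by simp)
  have hsize₄ : m₄ rSize 0 = K := by rw [h₄ rSize (by simp), hsize₃]
  have hmod : (Expr.load aUser (.mul (.add (.var rSize) (.lit 1))
      (.add (.var rSize) (.lit 1)))).eval m₄ = modulus n K := by
    rw [Expr.eval, hbound m₄ hsize₄, huser₄ _ le_rfl, modulus_eq]
  refine Runs.store (hmod ▸ hL.modulus_lt_two_pow) ?_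
  rw [hmod]
  exact
    { toInput := hinput hm₄ (agreeOff_write _ _ _ _) (by simp)
      size := by simpa using hsize₄
      two := by simpa [h₄ aTwo (by simp)] using htwo₃
      user := by simpa using huser₄
      mod := by simp [Expr.eval] }

end Preparation

section Weights

variable {k n K L : ℕ} {W : Schema (Fin k) (Fin n)} {m m' : Memory} {V : Finset (Fin K)}
  {g : Fin W.constraints.length}

/-- The prepared memory, with the code of `V` in the register of the current set. -/
structure AtSet (W : Schema (Fin k) (Fin n)) (K : ℕ) (V : Finset (Fin K)) (m : Memory) : Prop
    extends Prepared W K m where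
  set : m rSet 0 = code K V

/-- The prepared memory at set `V` and constraint `g`. -/
structure AtConstraint (W : Schema (Fin k) (Fin n)) (K : ℕ) (V : Finset (Fin K))
    (g : Fin W.constraints.length) (m : Memory) : Prop extends AtSet W K V m where
  con : m rCon 0 = g

theorem AtSet.of_agreeOff {w : List ℕ} (h : AtSet W K V m) (hw : AgreeOff w m m')
    (hdisj : ∀ a ∈ rSet :: preparedCells, a ∉ w) : AtSet W K V m' where
  toPrepared := h.toPrepared.of_agreeOff hw fun a ha => hdisj a (List.mem_cons_of_mem _ ha)
  set := by rw [hw rSet (hdisj _ (by simp)), h.set]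

theorem AtConstraint.of_agreeOff {w : List ℕ} (h : AtConstraint W K V g m) (hw : AgreeOff w m m')
    (hdisj : ∀ a ∈ rCon :: rSet :: preparedCells, a ∉ w) : AtConstraint W K V g m' where
  toAtSet := h.toAtSet.of_agreeOff hw fun a ha => hdisj a (List.mem_cons_of_mem _ ha)
  con := by rw [hw rCon (hdisj _ (by simp)), h.con]

/-- The numbers that decide whether a block `V` is compatible with constraint `g`. The steps are
the first `k` elements of the ground set. -/
structure Counted (W : Schema (Fin k) (Fin n)) (hK : k ≤ K) (V : Finset (Fin K))
    (g : Fin W.constraints.length) (m : Memory) : Prop extends AtConstraint W K V g m where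
  meets_left : m rLeft 0 ≠ 0 ↔ Meets (Fin.castLE hK) V (W.constraints.get g).left
  meets_right : m rRight 0 ≠ 0 ↔ Meets (Fin.castLE hK) V (W.constraints.get g).right
  single : m rSingle 0 = (W.constraints.get g).left.card
  pair : m rPair 0 = pairCode (W.constraints.get g)

/-- Computes the numbers listed in `Counted`. -/
def countConstraint : Program :=
  sum rLeft rElem numSteps .skip (.mul (leftBit (.var rCon) (.var rElem)) (memBit (.var rElem))) ;;
  sum rRight rElem numSteps .skip
    (.mul (rightBit (.var rCon) (.var rElem)) (memBit (.var rElem))) ;;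
  sum rSingle rElem numSteps .skip (leftBit (.var rCon) (.var rElem)) ;;
  sum rPair rElem numSteps .skip
    (.mul (.add (leftBit (.var rCon) (.var rElem))
        (.mul (.lit 2) (rightBit (.var rCon) (.var rElem))))
      (.mul (.load aTwo (.var rElem)) (.load aTwo (.var rElem))))

theorem sum_bit_mul_bit_ne_zero_iff (e : Fin k → Fin K) (A : Finset (Fin k)) :
    ∑ s, bit (s ∈ A) * bit (e s ∈ V) ≠ 0 ↔ Meets e V A := by
  simp [Finset.sum_eq_zero_iff, bit, Meets, and_comm]

theorem sum_bit_mul_bit_le (p q : Fin k → Prop) : ∑ s, bit (p s) * bit (q s) ≤ k :=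
  calc ∑ s, bit (p s) * bit (q s) ≤ ∑ _s : Fin k, 1 := Finset.sum_le_sum fun s _ =>
        Nat.mul_le_mul (bit_le_one _) (bit_le_one _)
    _ = k := by simp

theorem sum_bit_mem (A : Finset (Fin k)) : ∑ s, bit (s ∈ A) = A.card := by
  simp [sum_bit]

theorem runs_sum_steps {acc : ℕ} {val : Expr} (f : Fin k → ℕ)
    (hL : WordSize n W.constraints.length K L) (hK : k ≤ K) (hm : AtConstraint W K V g m)
    (hacc : acc ∉ rElem :: rCon :: rSet :: preparedCells) (hf : ∑ s, f s < 2 ^ L)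
    (hval : ∀ s m', AtConstraint W K V g m' → m' rElem 0 = (s : Fin k) → val.eval m' = f s) :
    Runs L (sum acc rElem numSteps .skip val) m (4 * K + 3) fun m' =>
      AtConstraint W K V g m' ∧ m' acc 0 = ∑ s, f s := by
  have hagree : ∀ {m'} {w : List ℕ}, (∀ a, a ∈ w → a = acc ∨ a = rElem) → AgreeOff w m m' →
      AtConstraint W K V g m' := fun hw h => hm.of_agreeOff h fun a ha haw => by
    rcases hw a haw with rfl | rfl
    · exact hacc (List.mem_cons_of_mem _ ha)
    · simp [preparedCells] at ha
  refine (Runs.sum_skip f (List.ne_of_not_mem_cons hacc)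
    (fun m' h => (hagree (by simp) h).toInput.eval_numSteps) (hK.trans_lt (hL.lt (by nlinarith))) hf
    fun s m' h => hval s m' (hagree (by simp) h)).conseq (by lia) fun m' h hsum => ?_
  exact ⟨hagree (by simp) h, hsum⟩

theorem runs_countConstraint (hL : WordSize n W.constraints.length K L) (hK : k ≤ K)
    (hm : AtConstraint W K V g m) :
    Runs L countConstraint m (16 * K + 12) (Counted W hK V g) := by
  have hk_lt : k < 2 ^ L := hK.trans_lt (hL.lt (by nlinarith))
  have hleft : ∀ s m', AtConstraint W K V g m' → m' rElem 0 = (s : Fin k) →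
      (leftBit (.var rCon) (.var rElem)).eval m' = bit (s ∈ (W.constraints.get g).left) :=
    fun s m' h hs => h.toInput.eval_leftBit h.con hs
  have hright : ∀ s m', AtConstraint W K V g m' → m' rElem 0 = (s : Fin k) →
      (rightBit (.var rCon) (.var rElem)).eval m' = bit (s ∈ (W.constraints.get g).right) :=
    fun s m' h hs => h.toInput.eval_rightBit h.con hs
  have hmem : ∀ s m', AtConstraint W K V g m' → m' rElem 0 = (s : Fin k) →
      (memBit (.var rElem)).eval m' = bit (Fin.castLE hK s ∈ V) :=
    fun s m' h hs => h.eval_memBit h.set hs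
  refine Runs.mono (τ₁ := (4 * K + 3) + ((4 * K + 3) + ((4 * K + 3) + (4 * K + 3)))) ?_ (by lia)
  refine Runs.seq (runs_sum_steps (fun s => bit (s ∈ (W.constraints.get g).left) *
    bit (Fin.castLE hK s ∈ V)) hL hK hm (by simp [preparedCells])
    ((sum_bit_mul_bit_le _ _).trans_lt hk_lt) fun s m' h hs => ?_) fun m₁ _ ⟨hm₁, hl⟩ => ?_
  · rw [Expr.eval, hleft s m' h hs, hmem s m' h hs]
  refine Runs.seq (runs_sum_steps (fun s => bit (s ∈ (W.constraints.get g).right) *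
    bit (Fin.castLE hK s ∈ V)) hL hK hm₁ (by simp [preparedCells])
    ((sum_bit_mul_bit_le _ _).trans_lt hk_lt) fun s m' h hs => ?_) fun m₂ h₂ ⟨hm₂, hr⟩ => ?_
  · rw [Expr.eval, hright s m' h hs, hmem s m' h hs]
  refine Runs.seq (runs_sum_steps _ hL hK hm₂ (by simp [preparedCells])
    (by rw [sum_bit_mem]; exact (card_finset_fin_le _).trans_lt hk_lt) hleft)
    fun m₃ h₃ ⟨hm₃, hs⟩ => ?_
  refine (runs_sum_steps (fun s => (bit (s ∈ (W.constraints.get g).left) +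
    2 * bit (s ∈ (W.constraints.get g).right)) * 4 ^ (s : ℕ)) hL hK hm₃ (by simp [preparedCells])
    ?_ fun s m' h hs => ?_).conseq le_rfl fun m₄ h₄ ⟨hm₄, hp⟩ => ?_
  · rw [← pairCode_val]
    calc _ < 4 ^ k := (pairCode _).isLt
      _ = 2 ^ (2 * k) := by rw [pow_mul]; rfl
      _ < 2 ^ L := hL.two_pow_lt (by nlinarith)
  · simp only [Expr.eval, hleft s m' h hs, hright s m' h hs, Expr.eval_var, hs,
      h.two s (s.isLt.le.trans hK), ← mul_pow]
    rfl
  exact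
    { toAtConstraint := hm₄
      meets_left := by
        rw [h₄ rLeft (by simp), h₃ rLeft (by simp), h₂ rLeft (by simp), hl]
        exact sum_bit_mul_bit_ne_zero_iff _ _
      meets_right := by
        rw [h₄ rRight (by simp), h₃ rRight (by simp), hr]
        exact sum_bit_mul_bit_ne_zero_iff _ _
      single := by rw [h₄ rSingle (by simp), hs, sum_bit_mem]
      pair := hp.trans (pairCode_val _).symm }

end Weights

section SubsetSumTable

variable {k n K L : ℕ} {W : Schema (Fin k) (Fin n)} {m m' : Memory} {V : Finset (Fin K)}
  {violTest : Expr} {viol : Finset (Fin K) → Fin W.constraints.length → Prop}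

/-- Once `countConstraint` has treated a set `V` and a constraint `g`, the test tells whether
`viol V g`. -/
def TestsViolation (hK : k ≤ K) (violTest : Expr)
    (viol : Finset (Fin K) → Fin W.constraints.length → Prop) : Prop :=
  ∀ V g m, Counted W hK V g m → (violTest.Holds m ↔ viol V g)

/-- Computes the cardinality of the current set. -/
def countElements : Program :=
  sum rCard rElem (.var rSize) .skip (memBit (.var rElem))

/-- Computes the number of constraints that the current set violates. -/
def countViolations (violTest : Expr) : Program :=
  sum rViol rCon numConstraints countConstraint violTest.indicator

theorem Prepared.eval_size (h : Prepared W K m) : (Expr.var rSize).eval m = K := h.size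

theorem Prepared.eval_numSets (h : Prepared W K m) :
    (Expr.load aTwo (.var rSize)).eval m = 2 ^ K := by
  rw [Expr.eval, h.eval_size, h.two K le_rfl]

theorem Prepared.atSet (h : Prepared W K m) {j : Fin (2 ^ K)} (hj : m rSet 0 = j) :
    AtSet W K ((code K).symm j) m :=
  ⟨h, by rw [hj, Equiv.apply_symm_apply]⟩

theorem runs_countElements (hL : WordSize n W.constraints.length K L) (hm : AtSet W K V m) :
    Runs L countElements m (4 * K + 3) fun m' => m' rCard 0 = V.card := by
  have hK_lt : K < 2 ^ L := hL.lt (by nlinarith)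
  refine (Runs.sum_skip (fun s => bit (s ∈ V)) (by simp)
    (fun m' h => (hm.of_agreeOff h (by simp [preparedCells])).eval_size) hK_lt
    (by rw [sum_bit_mem]; exact (card_finset_fin_le V).trans_lt hK_lt) fun s m' h hs => ?_).conseq
    (by lia) fun m' _ hsum => hsum.trans (sum_bit_mem V)
  have hm' := hm.of_agreeOff h (by simp [preparedCells])
  exact hm'.eval_memBit hm'.set hs

theorem runs_countViolations (hL : WordSize n W.constraints.length K L) (hK : k ≤ K)
    (htest : TestsViolation hK violTest viol) (hm : AtSet W K V m) :
    Runs L (countViolations violTest) m (W.constraints.length * (16 * K + 15) + 3)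
      fun m' => m' rViol 0 = 0 ↔ ∀ g, ¬ viol V g := by
  have hsum_le : ∑ g, bit (viol V g) ≤ W.constraints.length := by
    simpa using Finset.sum_le_card_nsmul Finset.univ (fun g => bit (viol V g)) 1
      fun g _ => bit_le_one _
  refine (Runs.sum (τ := 16 * K + 12) (fun g => bit (viol V g)) (by simp [countConstraint])
    (by simp) (by simp [countConstraint])
    (fun m' h => (hm.of_agreeOff h
      (by simp [countConstraint, preparedCells])).toInput.eval_numConstraints)
    hL.constraints_lt (hsum_le.trans_lt hL.constraints_lt) fun g m' h hg => ?_).conseq le_rfl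
    fun m' _ hsum => by simp [hsum, bit]
  have hm' : AtConstraint W K V g m' :=
    ⟨hm.of_agreeOff h (by simp [countConstraint, preparedCells]), hg⟩
  refine (runs_countConstraint hL hK hm').conseq le_rfl fun m'' _ hcounted => ?_
  rw [Expr.eval_indicator, htest V g m'' hcounted]

open Classical in
/-- The weight of `V` is the power of the base with exponent `|V|` if `V` violates no constraint,
and `0` otherwise. -/
noncomputable def blockWeight (n : ℕ) {K c : ℕ} (viol : Finset (Fin K) → Fin c → Prop)
    (V : Finset (Fin K)) : ℕ :=
  if ∀ g, ¬ viol V g then weightBase n K ^ V.card else 0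

theorem blockWeight_lt_modulus (n : ℕ) {c : ℕ} (viol : Finset (Fin K) → Fin c → Prop)
    (V : Finset (Fin K)) : blockWeight n viol V < modulus n K := by
  rw [blockWeight]
  split_ifs
  · exact pow_lt_modulus (card_finset_fin_le V)
  · exact zero_lt_one.trans (one_lt_modulus n K)

/-- Stores the weights of all sets of elements. -/
def computeWeights (violTest : Expr) : Program :=
  tabulate aSub rSet (.load aTwo (.var rSize)) (.lit 0)
    (countElements ;; countViolations violTest)
    (.mul (.not (.var rViol)) (.load aUser (.mul (.add (.var rSize) (.lit 1)) (.var rCard))))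

theorem runs_computeWeights (hL : WordSize n W.constraints.length K L) (hK : k ≤ K)
    (htest : TestsViolation hK violTest viol) (hm : Prepared W K m) :
    Runs L (computeWeights violTest) m
      (2 ^ K * (4 * K + W.constraints.length * (16 * K + 15) + 9) + 2) fun m' =>
        Prepared W K m' ∧ ∀ V, m' aSub (code K V) = blockWeight n viol V := by
  have hagree : ∀ m', AgreeOff (rSet :: aSub :: (countElements ;; countViolations violTest).writes)
      m m' → Prepared W K m' := fun m' h => hm.of_agreeOff h
        (by simp [countElements, countViolations, countConstraint, preparedCells])
  refine (Runs.tabulate (τ := 4 * K + 3 + (W.constraints.length * (16 * K + 15) + 3)) (o := 0)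
    (fun j => blockWeight n viol ((code K).symm j))
    (by simp [countElements, countViolations, countConstraint]) (by simp)
    (by simp [countElements, countViolations, countConstraint])
    (fun m' h => (hagree m' h).eval_numSets) (hL.two_pow_lt (by nlinarith)) (fun _ _ => rfl)
    (fun j => (blockWeight_lt_modulus n viol _).trans hL.modulus_lt_two_pow)
    fun j m₁ h₁ hj _ _ => ?_).conseq (Nat.add_le_add_right (Nat.mul_le_mul_left _ (by lia)) _)
    fun m' h hpost => ?_
  · have hm₁ := (hagree m₁ h₁).atSet hj
    refine Runs.seq (runs_countElements hL hm₁) fun m₂ h₂ hcard => ?_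
    have hm₂ := hm₁.of_agreeOff h₂ (by simp [countElements, preparedCells])
    refine (runs_countViolations hL hK htest hm₂).conseq le_rfl fun m₃ h₃ hviol => ?_
    have hm₃ := hm₂.of_agreeOff h₃ (by simp [countViolations, countConstraint, preparedCells])
    have hcard₃ : m₃ rCard 0 = ((code K).symm j).card := by
      rw [h₃ rCard (by simp [countViolations, countConstraint]), hcard]
    have hcard_le := card_finset_fin_le ((code K).symm j)
    simp only [Expr.eval, Expr.eval_var, Expr.not, hm₃.size, hcard₃,
      hm₃.user _ (Nat.mul_le_mul_left _ (hcard_le.trans K.le_succ))]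
    rw [blockWeight, weightBase, ← pow_mul]
    split_ifs with hall
    · rw [hviol.2 hall, Nat.sub_zero, one_mul]
    · rw [Nat.sub_eq_zero_of_le (Nat.one_le_iff_ne_zero.2 fun h => hall (hviol.1 h)), zero_mul]
  · refine ⟨hm.of_agreeOff h (by simp [countElements, countViolations, countConstraint,
      preparedCells]), fun V => ?_⟩
    simpa using hpost.2 (code K V)

/-- The prepared memory, with the sums of the weights `w` of the subsets of every set in the last
row of the array `aSub`. -/
structure SubsetSums (W : Schema (Fin k) (Fin n)) (w : Finset (Fin K) → ℕ) (m : Memory) : Prop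
    extends Prepared W K m where
  sub : ∀ V, m aSub (K * 2 ^ K + code K V) = (∑ T ∈ V.powerset, w T) % modulus n K

/-- Computes row `r + 1` of the array `aSub` from row `r`. Row `r` holds the sums over the sets that
arise by deleting elements below `r`. -/
def nextRow : Program :=
  tabulate aSub rSet (.load aTwo (.var rSize))
    (.mul (.add (.var rRow) (.lit 1)) (.load aTwo (.var rSize))) .skip
    (.mod (.add
      (.load aSub (.add (.mul (.var rRow) (.load aTwo (.var rSize))) (.var rSet)))
      (.mul (memBit (.var rRow))
        (.load aSub (.add (.mul (.var rRow) (.load aTwo (.var rSize)))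
          (.sub (.var rSet) (.load aTwo (.var rRow))))))) (.var rMod))

/-- Computes the sums over the subsets of every set. -/
def sumOverSubsets : Program := forLoop rRow (.var rSize) nextRow

theorem Prepared.of_agreeOff_aSub {w : List ℕ} (hm : Prepared W K m) (h : AgreeOff w m m')
    (hw : ∀ a ∈ w, a = aSub ∨ a = rSet ∨ a = rRow) : Prepared W K m' :=
  hm.of_agreeOff h fun a ha haw => by
    rcases hw a haw with rfl | rfl | rfl <;> simp [preparedCells] at ha

theorem runs_nextRow (hL : WordSize n W.constraints.length K L) {w : Finset (Fin K) → ℕ}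
    {r : Fin K} (hm : Prepared W K m) (hrow : m rRow 0 = r)
    (hprev : ∀ V, m aSub (r * 2 ^ K + code K V) = subsetSum w r V % modulus n K) :
    Runs L nextRow m (2 ^ K * 4 + 2) fun m' =>
      ∀ V, m' aSub ((r + 1) * 2 ^ K + code K V) = subsetSum w (r + 1) V % modulus n K := by
  refine (Runs.tabulate (τ := 1) (o := (r + 1) * 2 ^ K)
    (fun j => subsetSum w (r + 1) ((code K).symm j) % modulus n K) (by simp) (by simp) (by simp)
    (fun m' h => (hm.of_agreeOff_aSub h (by simp)).eval_numSets) (hL.two_pow_lt (by nlinarith))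
    (fun m' h => ?_)
    (fun j => (Nat.mod_lt _ (by linarith [one_lt_modulus n K])).trans hL.modulus_lt_two_pow)
    fun j m' h hj hlow _ => Runs.skip ?_).conseq le_rfl fun m' _ hpost V => ?_
  · rw [Expr.eval, (hm.of_agreeOff_aSub h (by simp)).eval_numSets, Expr.eval, Expr.eval_var,
      h rRow (by simp), hrow, Expr.eval]
  · have hset := (hm.of_agreeOff_aSub h (by simp)).atSet hj
    have hrow' : m' rRow 0 = r := by rw [h rRow (by simp), hrow]
    have hprev' : ∀ V, m' aSub (r * 2 ^ K + code K V) = subsetSum w r V % modulus n K := fun V => by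
      rw [hlow _ (by linarith [(code K V).isLt]), hprev]
    simp only [Expr.eval_mod, Expr.eval, hset.eval_memBit (x := .var rRow) hset.set hrow',
      Expr.eval_var, hrow', hset.size, hset.mod, hset.two K le_rfl, hset.two r r.isLt.le, hset.set,
      hprev']
    rw [subsetSum_succ]
    by_cases hr : r ∈ (code K).symm j
    · rw [bit, if_pos hr, if_pos hr, one_mul, ← code_erase hr, hprev', ← Nat.add_mod]
    · rw [bit, if_neg hr, if_neg hr, zero_mul, add_zero, add_zero, Nat.mod_mod]
  · simpa using hpost.2 (code K V)

theorem runs_sumOverSubsets (hL : WordSize n W.constraints.length K L) {w : Finset (Fin K) → ℕ}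
    (hw : ∀ V, w V < modulus n K) (hm : Prepared W K m)
    (hinit : ∀ V, m aSub (code K V) = w V) :
    Runs L sumOverSubsets m (K * (2 ^ K * 4 + 4) + 2) (SubsetSums W w) := by
  refine (Runs.forLoop (τ := 2 ^ K * 4 + 2)
    (fun r m' => ∀ V, m' aSub (r * 2 ^ K + code K V) = subsetSum w r V % modulus n K)
    (by simp [nextRow]) (fun m' h => (hm.of_agreeOff_aSub h (by simp [nextRow])).eval_size)
    (hL.lt (by nlinarith)) (fun j m' x h => by simpa using h)
    (fun V => by simpa [Nat.mod_eq_of_lt (hw V)] using hinit V) fun r m' hr h hrow hprev =>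
      runs_nextRow (r := ⟨r, hr⟩) hL (hm.of_agreeOff_aSub h (by simp [nextRow])) hrow hprev).conseq
    le_rfl fun m' h hsum => ⟨hm.of_agreeOff_aSub h (by simp [nextRow]), fun V => ?_⟩
  rw [hsum, subsetSum_top]

end SubsetSumTable

section Decision

variable {k n K L f : ℕ} {W : Schema (Fin k) (Fin n)} {m m' : Memory} {o : ℕ → ℕ}
  {w : Finset (Fin K) → ℕ}

open Classical in
/-- The elements that may be mapped to user `u`, if the users of the first `f` steps are fixed by
the output `o`. -/
noncomputable def allowed (W : Schema (Fin k) (Fin n)) (K f : ℕ) (o : ℕ → ℕ) (u : Fin n) :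
    Finset (Fin K) :=
  Finset.univ.filter fun x => (∀ h : (x : ℕ) < k, W.auth ⟨x, h⟩ u) ∧ (x < f → o (x + 1) = u)

/-- The output `o` for the first `f` steps extends to an authorized map on the ground set none of
whose fibers violates a constraint. -/
def Feasible (W : Schema (Fin k) (Fin n)) {c : ℕ} (viol : Finset (Fin K) → Fin c → Prop) (f : ℕ)
    (o : ℕ → ℕ) : Prop :=
  ∃ φ : Fin K → Fin n, (∀ (x : Fin K) (h : (x : ℕ) < k), W.auth ⟨x, h⟩ (φ x)) ∧
    (∀ x : Fin K, (x : ℕ) < f → o (x + 1) = φ x) ∧ ∀ u g, ¬ viol (fiber φ u) g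

theorem feasible_iff {c : ℕ} {viol : Finset (Fin K) → Fin c → Prop} :
    Feasible W viol f o ↔ ∃ φ : Fin K → Fin n, ∀ u,
      fiber φ u ⊆ allowed W K f o u ∧ ∀ g, ¬ viol (fiber φ u) g := by
  refine exists_congr fun φ => ?_
  simp only [allowed, Finset.subset_iff, mem_fiber, Finset.mem_filter_univ, forall_and]
  grind

/-- The sign `(-1) ^ |X|` modulo `M`, as a number below `M`. -/
def signMod (M : ℕ) (X : Finset (Fin K)) : ℕ := 1 - X.card % 2 + X.card % 2 * (M - 1)

theorem signMod_lt {M : ℕ} (hM : 1 < M) (X : Finset (Fin K)) : signMod M X < M := by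
  rw [signMod]
  rcases Nat.mod_two_eq_zero_or_one X.card with h | h <;> rw [h] <;> lia

theorem cast_signMod {M : ℕ} (hM : 1 < M) (X : Finset (Fin K)) :
    (signMod M X : ZMod M) = (-1) ^ X.card := by
  rw [signMod, neg_one_pow_eq_pow_mod_two]
  rcases Nat.mod_two_eq_zero_or_one X.card with h | h <;> simp [h, Nat.cast_sub hM.le]

/-- The summand for `X` of the alternating sum of the inclusion-exclusion principle, computed
modulo `modulus n K`. -/
noncomputable def summand (W : Schema (Fin k) (Fin n)) (w : Finset (Fin K) → ℕ) (f : ℕ)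
    (o : ℕ → ℕ) (X : Finset (Fin K)) : ℕ :=
  signMod (modulus n K) X *
    (∏ u, (∑ T ∈ (X ∩ allowed W K f o u).powerset, w T) % modulus n K) % modulus n K

theorem sum_summand_mod_ne_zero_iff {c : ℕ} {viol : Finset (Fin K) → Fin c → Prop} :
    (∑ X, summand W (blockWeight n viol) f o X) % modulus n K ≠ 0 ↔ Feasible W viol f o := by
  classical
  rw [Ne, ← Nat.dvd_iff_mod_eq_zero, ← ZMod.natCast_eq_zero_iff, feasible_iff,
    ← sum_neg_one_pow_mul_prod_ne_zero_iff (B := weightBase n K) (M := modulus n K)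
      (fun u V => V ⊆ allowed W K f o u ∧ ∀ g, ¬ viol V g)
      (by simpa using pow_lt_weightBase n K) (by simp [modulus])]
  push_cast [summand, ZMod.natCast_mod, cast_signMod (one_lt_modulus n K)]
  refine not_congr (Eq.congr_left (Finset.sum_congr rfl fun X _ =>
    congrArg _ (Finset.prod_congr rfl fun u _ => ?_)))
  have hpowerset : (X ∩ allowed W K f o u).powerset
      = X.powerset.filter fun V => V ⊆ allowed W K f o u := by
    ext V
    simp only [Finset.mem_powerset, Finset.mem_filter, Finset.subset_inter_iff]
  simp only [hpowerset, Finset.sum_filter, blockWeight]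
  exact Finset.sum_congr rfl fun V _ => by split_ifs <;> simp_all

/-- The memory after the summation, with the users of the first `f` steps fixed by the
output `o`. -/
structure AtPartialPlan (W : Schema (Fin k) (Fin n)) (w : Finset (Fin K) → ℕ) (f : ℕ) (o : ℕ → ℕ)
    (m : Memory) : Prop extends SubsetSums W w m where
  fixed : m rFixed 0 = f
  out : m aOut = o

theorem SubsetSums.of_agreeOff {x : List ℕ} (h : SubsetSums W w m) (hx : AgreeOff x m m')
    (hdisj : ∀ a ∈ aSub :: preparedCells, a ∉ x) : SubsetSums W w m' where
  toPrepared := h.toPrepared.of_agreeOff hx fun a ha => hdisj a (List.mem_cons_of_mem _ ha)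
  sub := by rw [hx aSub (hdisj _ (by simp))]; exact h.sub

theorem AtPartialPlan.of_agreeOff {x : List ℕ} (h : AtPartialPlan W w f o m)
    (hx : AgreeOff x m m') (hdisj : ∀ a ∈ aOut :: rFixed :: aSub :: preparedCells, a ∉ x) :
    AtPartialPlan W w f o m' where
  toSubsetSums := h.toSubsetSums.of_agreeOff hx fun a ha =>
    hdisj a (List.mem_cons_of_mem _ (List.mem_cons_of_mem _ ha))
  fixed := by rw [hx rFixed (hdisj _ (by simp)), h.fixed]
  out := by rw [hx aOut (hdisj _ (by simp)), h.out]

/-- Tests whether the current element belongs to the current set and may be mapped to the current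
user. -/
def allowedTest : Expr :=
  .mul (memBit (.var rElem))
    (.mul (.add (.not (.lt (.var rElem) numSteps)) (authBit (.var rElem) (.var rUser)))
      (.add (.not (.lt (.var rElem) (.var rFixed)))
        (.not (.ne (.load aOut (.add (.var rElem) (.lit 1))) (.var rUser)))))

/-- Computes the code of the set of the elements that pass `allowedTest`. -/
def codeAllowed : Program :=
  sum rAllowed rElem (.var rSize) .skip
    (.mul allowedTest.indicator (.load aTwo (.var rElem)))

/-- Computes the summand for the current set. -/
def computeSummand : Program :=
  countElements ;;
  prodMod rProd rUser numUsers
    (.add (.sub (.lit 1) (.mod (.var rCard) (.lit 2)))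
      (.mul (.mod (.var rCard) (.lit 2)) (.sub (.var rMod) (.lit 1))))
    codeAllowed
    (.load aSub (.add (.mul (.var rSize) (.load aTwo (.var rSize))) (.var rAllowed)))
    (.var rMod)

/-- Computes the alternating sum. -/
def decideFeasible : Program :=
  sum rTotal rSet (.load aTwo (.var rSize)) computeSummand (.var rProd)

/-- After `decideFeasible`, tests whether the partial plan extends. -/
def feasibleTest : Expr := .mod (.var rTotal) (.var rMod)

theorem holds_allowedTest {X : Finset (Fin K)} {x : Fin K} {u : Fin n}
    (hm : AtPartialPlan W w f o m) (hset : m rSet 0 = code K X) (hu : m rUser 0 = u)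
    (hx : m rElem 0 = x) : allowedTest.Holds m ↔ x ∈ X ∩ allowed W K f o u := by
  have hmem : (memBit (.var rElem)).Holds m ↔ x ∈ X := by
    rw [Expr.Holds, hm.eval_memBit (x := .var rElem) hset hx, bit_ne_zero]
  have hauth : ∀ h : (x : ℕ) < k, (authBit (.var rElem) (.var rUser)).Holds m ↔
      W.auth ⟨x, h⟩ u := fun h => by
    rw [Expr.Holds,
      hm.toInput.eval_authBit (s := .var rElem) (u := .var rUser) (s' := ⟨x, h⟩) hx hu, bit_ne_zero]
  simp only [allowedTest, Expr.holds_mul, Expr.holds_add, Expr.holds_not, Expr.holds_lt,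
    Expr.holds_ne, Expr.eval_var, Expr.eval, hm.toInput.eval_numSteps, hm.fixed, hm.out, hu, hx,
    hmem, allowed, Finset.mem_inter, Finset.mem_filter_univ]
  grind

theorem runs_codeAllowed {X : Finset (Fin K)} {u : Fin n}
    (hL : WordSize n W.constraints.length K L) (hm : AtPartialPlan W w f o m)
    (hset : m rSet 0 = code K X) (hu : m rUser 0 = u) :
    Runs L codeAllowed m (4 * K + 3) fun m' =>
      m' rAllowed 0 = code K (X ∩ allowed W K f o u) := by
  rw [code_eq_sum]
  refine (Runs.sum_skip _ (by simp)
    (fun m' h => (hm.of_agreeOff h (by simp [preparedCells])).eval_size) (hL.lt (by nlinarith))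
    ?_ fun x m' h hx => ?_).mono (by lia)
  · rw [← code_eq_sum]
    exact (code K _).isLt.trans (hL.two_pow_lt (by nlinarith))
  · have hm' := hm.of_agreeOff h (by simp [preparedCells])
    rw [Expr.eval, Expr.eval_indicator, holds_allowedTest hm' (by rw [h rSet (by simp), hset])
      (by rw [h rUser (by simp), hu]) hx, Expr.eval, Expr.eval_var, hx, hm'.two x x.isLt.le]

theorem runs_computeSummand {X : Finset (Fin K)} (hL : WordSize n W.constraints.length K L)
    (hm : AtPartialPlan W w f o m) (hset : m rSet 0 = code K X) :
    Runs L computeSummand m (4 * K + n * (4 * K + 6) + 6) fun m' =>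
      m' rProd 0 = summand W w f o X := by
  have hM := one_lt_modulus n K
  refine Runs.mono (τ₁ := 4 * K + 3 + (n * (4 * K + 3 + 3) + 3)) ?_ (by lia)
  refine Runs.seq (runs_countElements hL ⟨hm.toPrepared, hset⟩) fun m₁ h₁ hcard => ?_
  have hm₁ := hm.of_agreeOff h₁ (by simp [countElements, preparedCells])
  have hset₁ : m₁ rSet 0 = code K X := by rw [h₁ rSet (by simp [countElements]), hset]
  refine Runs.prodMod _ (by simp [codeAllowed]) (by simp) (by simp [codeAllowed])
    (fun m₂ h₂ => (hm₁.of_agreeOff h₂ (by simp [codeAllowed, preparedCells])).toInput.eval_numUsers)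
    hL.users_lt ?_ (signMod_lt hM X) hL.modulus_lt_two_pow.le fun u m₂ h₂ hu => ?_
  · simp only [Expr.eval, Expr.eval_mod, Expr.eval_var, hcard, hm₁.mod, signMod]
  · have hm₂ := hm₁.of_agreeOff h₂ (by simp [codeAllowed, preparedCells])
    have hset₂ : m₂ rSet 0 = code K X := by rw [h₂ rSet (by simp [codeAllowed]), hset₁]
    refine (runs_codeAllowed hL hm₂ hset₂ hu).conseq le_rfl fun m₃ h₃ hallowed => ?_
    have hm₃ := hm₂.of_agreeOff h₃ (by simp [codeAllowed, preparedCells])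
    refine ⟨hm₃.mod, ?_⟩
    rw [Expr.eval, Expr.eval, Expr.eval, hm₃.eval_size, hm₃.eval_numSets, Expr.eval_var, hallowed,
      hm₃.sub]

theorem runs_decideFeasible {viol : Finset (Fin K) → Fin W.constraints.length → Prop}
    (hL : WordSize n W.constraints.length K L)
    (hm : AtPartialPlan W (blockWeight n viol) f o m) :
    Runs L decideFeasible m (2 ^ K * (4 * K + n * (4 * K + 6) + 9) + 3) fun m' =>
      feasibleTest.Holds m' ↔ Feasible W viol f o := by
  set s := summand W (blockWeight n viol) f o
  have hagree : ∀ {m' : Memory}, AgreeOff (rSet :: rTotal :: computeSummand.writes) m m' →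
      AtPartialPlan W (blockWeight n viol) f o m' := fun h => hm.of_agreeOff h
    (by simp [computeSummand, countElements, codeAllowed, preparedCells])
  have hlt : ∑ j, s ((code K).symm j) < 2 ^ L := by
    refine lt_of_le_of_lt ?_ hL.modulus_lt
    simpa using Finset.sum_le_card_nsmul Finset.univ (fun j => s ((code K).symm j)) (modulus n K)
      fun j _ => (Nat.mod_lt _ (by linarith [one_lt_modulus n K])).le
  refine (Runs.sum (fun j => s ((code K).symm j))
    (by simp [computeSummand, countElements, codeAllowed]) (by simp)
    (by simp [computeSummand, countElements, codeAllowed])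
    (fun m' h => (hagree h).eval_numSets) (hL.two_pow_lt (by nlinarith)) hlt fun j m' h hj =>
      runs_computeSummand hL (hagree h) ((hagree h).atSet hj).set).conseq le_rfl fun m' h hsum => ?_
  have hmod : m' rMod 0 = modulus n K := (hm.of_agreeOff h
    (by simp [computeSummand, countElements, codeAllowed, preparedCells])).mod
  rw [← sum_summand_mod_ne_zero_iff, feasibleTest, Expr.Holds, Expr.eval_mod, Expr.eval_var,
    Expr.eval_var, hsum, hmod, Equiv.sum_comp (code K).symm s]

end Decision

section Search

variable {k n K L f : ℕ} {W : Schema (Fin k) (Fin n)} {m : Memory}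
  {viol : Finset (Fin K) → Fin W.constraints.length → Prop}

theorem Feasible.exists_update {o : ℕ → ℕ} (h : Feasible W viol f o) (hf : f < K) :
    ∃ u : Fin n, Feasible W viol (f + 1) (Function.update o (f + 1) u) := by
  obtain ⟨φ, hauth, hout, hviol⟩ := h
  refine ⟨φ ⟨f, hf⟩, φ, hauth, fun x hx => ?_, hviol⟩
  rcases (Nat.lt_succ_iff.1 hx).lt_or_eq with hlt | rfl
  · rw [Function.update_of_ne (by lia), hout x hlt]
  · exact Function.update_self _ _ _

/-- Tries the current choice for the current step, unless the last choice was successful. -/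
def tryUser : Program :=
  .branch feasibleTest .skip
    (.store aOut (.add (.var rStep) (.lit 1)) (.var rChoice) ;; decideFeasible)

/-- Finds a user for the current step. -/
def extendPlan : Program :=
  .store rFixed (.lit 0) (.add (.var rStep) (.lit 1)) ;;
  .store rTotal (.lit 0) (.lit 0) ;;
  forLoop rChoice numUsers tryUser

/-- Writes the output. -/
def search : Program :=
  .store rFixed (.lit 0) (.lit 0) ;;
  decideFeasible ;;
  .store aOut (.lit 0) feasibleTest.indicator ;;
  .branch feasibleTest (forLoop rStep numSteps extendPlan) .skip

/-- A bound for the number of elementary steps of `decideFeasible`. -/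
def decideTime (n K : ℕ) : ℕ := 2 ^ K * (4 * K + n * (4 * K + 6) + 9) + 3

/-- The choices below `j` for the user of the step after the first `f` steps have been tried, and
the last one is in the output if it was successful. -/
structure Tried (W : Schema (Fin k) (Fin n))
    (viol : Finset (Fin K) → Fin W.constraints.length → Prop) (f : ℕ) (o : ℕ → ℕ) (j : ℕ)
    (m : Memory) : Prop where
  out : ∀ i ≠ f + 1, m aOut i = o i
  success : feasibleTest.Holds m → Feasible W viol (f + 1) (m aOut)
  failure : ¬ feasibleTest.Holds m →
    ∀ u < j, ¬ Feasible W viol (f + 1) (Function.update o (f + 1) u)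

theorem runs_tryUser {o : ℕ → ℕ} {j : ℕ} (hL : WordSize n W.constraints.length K L)
    (hm : SubsetSums W (blockWeight n viol) m) (hfixed : m rFixed 0 = f + 1)
    (hstep : m rStep 0 = f) (hchoice : m rChoice 0 = j) (hj : j < n)
    (htried : Tried W viol f o j m) :
    Runs L tryUser m (decideTime n K + 2) (Tried W viol f o (j + 1)) := by
  refine (Runs.branch (τ := 1 + decideTime n K) (fun h => ?_) fun h => ?_).mono (by lia)
  · exact (Runs.skip (Q := Tried W viol f o (j + 1))
      ⟨htried.out, htried.success, fun h' => absurd h h'⟩).mono (by lia)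
  · refine Runs.seq (Runs.store (hchoice.trans_lt (hj.trans hL.users_lt)) rfl) ?_
    rintro m₁ h₁ rfl
    have hout : (m.write aOut (f + 1) j) aOut = Function.update o (f + 1) j := by
      rw [Memory.write_same]
      exact Function.update_eq_iff.2 ⟨by simp, fun i hi => by
        rw [Function.update_of_ne hi, htried.out i hi]⟩
    simp only [Expr.eval, Expr.eval_var, hstep, hchoice] at h₁ ⊢
    have hm₁ : AtPartialPlan W (blockWeight n viol) (f + 1) (Function.update o (f + 1) j)
        (m.write aOut (f + 1) j) :=
      ⟨hm.of_agreeOff h₁ (by simp [preparedCells]), by rw [h₁ rFixed (by simp), hfixed], hout⟩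
    refine (runs_decideFeasible hL hm₁).conseq le_rfl fun m₂ h₂ hfeas => ?_
    have hout₂ : m₂ aOut = Function.update o (f + 1) j := by
      rw [h₂ aOut (by simp [decideFeasible, computeSummand, countElements, codeAllowed]), hout]
    refine ⟨fun i hi => by rw [hout₂, Function.update_of_ne hi], fun h => hout₂ ▸ hfeas.1 h,
      fun h' u hu => ?_⟩
    rcases (Nat.lt_succ_iff.1 hu).lt_or_eq with hlt | rfl
    · exact htried.failure (not_not.2 h) u hlt
    · exact fun h => h' (hfeas.2 h)

theorem runs_extendPlan (hL : WordSize n W.constraints.length K L)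
    (hm : SubsetSums W (blockWeight n viol) m) (hstep : m rStep 0 = f) (hf : f < K)
    (hfeas : Feasible W viol f (m aOut)) :
    Runs L extendPlan m (n * (decideTime n K + 4) + 4) fun m' =>
      Feasible W viol (f + 1) (m' aOut) ∧ m' aOut 0 = m aOut 0 := by
  have hf_lt : f + 1 < 2 ^ L := hL.lt (by nlinarith)
  refine Runs.mono (τ₁ := 1 + (1 + (n * (decideTime n K + 2 + 2) + 2))) ?_ (by lia)
  refine Runs.seq (Runs.store (by simpa [Expr.eval, hstep] using hf_lt) rfl) ?_
  rintro m₁ h₁ rfl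
  refine Runs.seq (Runs.store (by simp [Expr.eval]) rfl) ?_
  rintro m₂ h₂ rfl
  simp only [Expr.eval, Expr.eval_var, hstep] at h₁ h₂ ⊢
  set m₂ := (m.write rFixed 0 (f + 1)).write rTotal 0 0 with hm₂_eq
  have hm₂ : SubsetSums W (blockWeight n viol) m₂ :=
    (hm.of_agreeOff h₁ (by simp [preparedCells])).of_agreeOff h₂ (by simp [preparedCells])
  have hinit : Tried W viol f (m aOut) 0 m₂ :=
    ⟨fun i _ => by simp [hm₂_eq], fun h => by simp [hm₂_eq, feasibleTest, Expr.Holds] at h,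
      fun _ u hu => absurd hu u.not_lt_zero⟩
  have htest : ∀ (m' : Memory) x,
      feasibleTest.Holds (m'.write rChoice 0 x) ↔ feasibleTest.Holds m' := fun m' x => by
    simp [feasibleTest, Expr.Holds]
  have hagree : ∀ {m'}, AgreeOff (rChoice :: tryUser.writes) m₂ m' →
      SubsetSums W (blockWeight n viol) m' := fun h => hm₂.of_agreeOff h (by
    simp [tryUser, decideFeasible, computeSummand, countElements, codeAllowed, Program.writes,
      preparedCells])
  have hkeep : ∀ a ∈ [rFixed, rStep], a ∉ rChoice :: tryUser.writes := by
    simp [tryUser, decideFeasible, computeSummand, countElements, codeAllowed, Program.writes]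
  refine (Runs.forLoop (Tried W viol f (m aOut))
    (by simp [tryUser, decideFeasible, computeSummand, countElements, codeAllowed, Program.writes])
    (fun m' h => (hagree h).toInput.eval_numUsers) hL.users_lt
    (fun j m' x h => ⟨by simpa using h.out, by simpa [htest] using h.success,
      by simpa [htest] using h.failure⟩) hinit
    fun j m' hj h hchoice htried => runs_tryUser hL (hagree h)
      (by rw [h rFixed (hkeep _ (by simp))]; simp [hm₂_eq])
      (by rw [h rStep (hkeep _ (by simp))]; simpa [hm₂_eq] using hstep) hchoice hj htried).conseq
    le_rfl fun m' _ htried => ?_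
  obtain ⟨u, hu⟩ := hfeas.exists_update hf
  exact ⟨htried.success (not_not.1 fun h => htried.failure h u u.isLt hu), htried.out 0 (by lia)⟩

theorem runs_extendPlans (hL : WordSize n W.constraints.length K L) (hK : k ≤ K)
    (hm : SubsetSums W (blockWeight n viol) m) (hfeas : Feasible W viol 0 (m aOut))
    (hout : m aOut 0 = 1) :
    Runs L (forLoop rStep numSteps extendPlan) m (k * (n * (decideTime n K + 4) + 6) + 2)
      fun m' => Feasible W viol k (m' aOut) ∧ m' aOut 0 = 1 := by
  have hagree : ∀ {m'}, AgreeOff (rStep :: extendPlan.writes) m m' →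
      SubsetSums W (blockWeight n viol) m' := fun h => hm.of_agreeOff h (by
    simp [extendPlan, tryUser, decideFeasible, computeSummand, countElements, codeAllowed,
      Program.writes, preparedCells])
  refine Runs.forLoop (fun f m' => Feasible W viol f (m' aOut) ∧ m' aOut 0 = 1)
    (by simp [extendPlan, tryUser, decideFeasible, computeSummand, countElements, codeAllowed,
      Program.writes])
    (fun m' h => (hagree h).toInput.eval_numSteps) (hK.trans_lt (hL.lt (by nlinarith)))
    (fun f m' x h => by simpa using h) ⟨hfeas, hout⟩ fun f m' hf h hstep hm' => ?_
  exact (runs_extendPlan hL (hagree h) hstep (hf.trans_le hK) hm'.1).conseq le_rfl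
    fun m'' _ h => ⟨h.1, h.2.trans hm'.2⟩

theorem runs_search (hL : WordSize n W.constraints.length K L) (hK : k ≤ K)
    (hm : SubsetSums W (blockWeight n viol) m) :
    Runs L search m (k * (n * (decideTime n K + 4) + 6) + decideTime n K + 5) fun m' =>
      Feasible W viol k (m' aOut) ∧ m' aOut 0 = 1 ∨
        ¬ Feasible W viol 0 (m' aOut) ∧ m' aOut 0 = 0 := by
  have hbase : ∀ o o', Feasible W viol 0 o ↔ Feasible W viol 0 o' := by simp [Feasible]
  refine Runs.mono (τ₁ := 1 + (decideTime n K +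
    (1 + (1 + (k * (n * (decideTime n K + 4) + 6) + 2))))) ?_ (by lia)
  refine Runs.seq (Runs.store (by simp [Expr.eval]) rfl) ?_
  rintro m₁ h₁ rfl
  have hm₁ := hm.of_agreeOff h₁ (by simp [preparedCells])
  refine Runs.seq (runs_decideFeasible (f := 0) (o := m aOut) hL
    ⟨hm₁, by simp [Expr.eval], by simp⟩) fun m₂ h₂ hfeas => ?_
  have hm₂ := hm₁.of_agreeOff h₂
    (by simp [decideFeasible, computeSummand, countElements, codeAllowed, preparedCells])
  refine Runs.seq (Runs.store (by
    rw [Expr.eval_indicator]; exact (bit_le_one _).trans_lt (hL.lt (by nlinarith))) rfl) ?_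
  rintro m₃ h₃ rfl
  set m₃ := m₂.write aOut ((Expr.lit 0).eval m₂) (feasibleTest.indicator.eval m₂) with hm₃_eq
  have hm₃ : SubsetSums W (blockWeight n viol) m₃ := hm₂.of_agreeOff h₃ (by simp [preparedCells])
  have hout : m₃ aOut 0 = bit (Feasible W viol 0 (m aOut)) := by
    rw [hm₃_eq, Memory.write_same, Expr.eval, Function.update_self, Expr.eval_indicator, hfeas]
  have htest : feasibleTest.Holds m₃ ↔ Feasible W viol 0 (m₃ aOut) := by
    rw [hbase _ (m aOut), ← hfeas]
    simp [hm₃_eq, feasibleTest, Expr.Holds]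
  refine Runs.branch (fun h => ?_) fun h => ?_
  · refine (runs_extendPlans hL hK hm₃ (htest.1 h) ?_).conseq le_rfl fun m' _ h => Or.inl h
    rw [hout, bit, if_pos ((hbase _ _).1 (htest.1 h))]
  · refine (Runs.skip (Or.inr ⟨fun hfeas => htest.2 hfeas h, ?_⟩)).mono (by lia)
    rw [hout, bit, if_neg fun hfeas => htest.2 ((hbase _ _).1 hfeas) h]

end Search

section Time

variable {K : ℕ} {I : Instance} {size violTest : Expr}

/-- The solver for a ground set whose size is the value of `size`. -/
def solve (size violTest : Expr) : Program :=
  prepare size ;; computeWeights violTest ;; sumOverSubsets ;; search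

theorem correctOutput_of_feasible {m : Memory} (hK : I.k ≤ K)
    {viol : Finset (Fin K) → Fin I.schema.constraints.length → Prop}
    (hcrit : BlockCriterion I.schema (Fin.castLE hK) viol)
    (h : Feasible I.schema viol I.k (m aOut) ∧ m aOut 0 = 1 ∨
      ¬ Feasible I.schema viol 0 (m aOut) ∧ m aOut 0 = 0) : I.CorrectOutput m := by
  refine h.imp ?_ fun ⟨hinfeas, hout⟩ => ⟨?_, hout⟩
  · rintro ⟨⟨φ, hauth, hφ, hviol⟩, hout⟩
    exact ⟨φ ∘ Fin.castLE hK, ⟨fun s => hauth (Fin.castLE hK s) s.isLt, hcrit.sound φ hviol⟩, hout,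
      fun s => hφ (Fin.castLE hK s) s.isLt⟩
  · rintro ⟨π, hauth, hsat⟩
    obtain ⟨φ, rfl, hviol⟩ := hcrit.complete π hsat
    exact hinfeas ⟨φ, fun x hx => hauth ⟨x, hx⟩, fun x hx => absurd hx (Nat.not_lt_zero _), hviol⟩

/-- On the instance `I`, the solver works with a ground set of size `K`, whose first `I.k` elements
are the steps, and with a criterion for the blocks that is decided by `violTest`. -/
structure BlockTest (size violTest : Expr) (I : Instance) (K : ℕ) : Prop where
  le : I.k ≤ K
  eq_zero : I.c + I.n ^ 2 = 0 → K = 0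
  eval_size : ∀ m, Input I.schema m → (∀ j ≤ I.k, m aTwo j = 2 ^ j) → size.eval m = K
  exists_criterion : ∃ viol, BlockCriterion I.schema (Fin.castLE le) viol ∧
    TestsViolation le violTest viol

theorem decideTime_le (n K : ℕ) : decideTime n K ≤ 12 * (2 ^ K * (K + 1) * (n + 1)) := by
  have hP : 1 ≤ 2 ^ K * (K + 1) * (n + 1) := Nat.mul_pos (by positivity) n.succ_pos
  calc decideTime n K ≤ 2 ^ K * (9 * ((K + 1) * (n + 1))) + 3 := by
        rw [decideTime]
        gcongr
        nlinarith
    _ ≤ 12 * (2 ^ K * (K + 1) * (n + 1)) := by linarith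

theorem search_time_le {k n K : ℕ} (hK : k ≤ K) :
    k * (n * (decideTime n K + 4) + 6) + decideTime n K + 5
      ≤ 34 * (2 ^ K * (K + 1) ^ 2 * (n ^ 2 + 1)) := by
  have hdecide := decideTime_le n K
  set D := decideTime n K
  set A := 2 ^ K * (K + 1)
  set B := A * (n ^ 2 + 1)
  have hA : 1 ≤ A := Nat.mul_pos (by positivity) K.succ_pos
  have hle_B {x : ℕ} (hx : x ≤ n ^ 2 + 1) : x ≤ B := hx.trans (Nat.le_mul_of_pos_left _ hA)
  have hn : n ≤ n ^ 2 + 1 := (Nat.le_self_pow two_ne_zero n).trans (n ^ 2).le_succ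
  have hD : D ≤ 24 * B := by
    calc D ≤ 12 * (A * (n + 1)) := hdecide
      _ ≤ 12 * (A * (2 * (n ^ 2 + 1))) := by gcongr; lia
      _ = 24 * B := by ring
  have hnD : n * D ≤ 24 * B := by
    calc n * D ≤ n * (12 * (A * (n + 1))) := by gcongr
      _ = 12 * (A * (n ^ 2 + n)) := by ring
      _ ≤ 12 * (A * (2 * (n ^ 2 + 1))) := by gcongr; lia
      _ = 24 * B := by ring
  calc k * (n * (D + 4) + 6) + D + 5 = k * (n * D + 4 * n + 6) + D + 5 := by ring
    _ ≤ K * (24 * B + 4 * B + 6 * B) + 34 * B := by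
      have h1 := hle_B (n ^ 2).succ_pos
      have h2 : k * (n * D + 4 * n + 6) ≤ K * (24 * B + 4 * B + 6 * B) := by
        gcongr
        exacts [hle_B hn, by lia]
      lia
    _ = 34 * (2 ^ K * (K + 1) ^ 2 * (n ^ 2 + 1)) := by ring

theorem solve_time_le {k n c K : ℕ} (hK : k ≤ K) :
    4 * (k + K + (K + 1) * (K + 1)) + 11 + ((2 ^ K * (4 * K + c * (16 * K + 15) + 9) + 2) +
      ((K * (2 ^ K * 4 + 4) + 2) + (k * (n * (decideTime n K + 4) + 6) + decideTime n K + 5)))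
    ≤ 85 * (2 ^ K * (K + 1) ^ 2 * (c + n ^ 2 + 1)) := by
  have hP : 1 ≤ 2 ^ K := Nat.one_le_two_pow
  set P := 2 ^ K
  set T := P * (K + 1) ^ 2 * (c + n ^ 2 + 1)
  have hle_T {a b c' : ℕ} (ha : a ≤ P) (hb : b ≤ (K + 1) ^ 2) (hc : c' ≤ c + n ^ 2 + 1) :
      a * b * c' ≤ T :=
    Nat.mul_le_mul (Nat.mul_le_mul ha hb) hc
  have hprepare : 4 * (k + K + (K + 1) * (K + 1)) + 11 ≤ 23 * T := by
    have := hle_T hP le_rfl (by lia : 1 ≤ c + n ^ 2 + 1)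
    nlinarith
  have hweights : P * (4 * K + c * (16 * K + 15) + 9) + 2 ≤ 18 * T := by
    have h1 := hle_T le_rfl (by nlinarith : K + 1 ≤ (K + 1) ^ 2) (by lia : c + 1 ≤ c + n ^ 2 + 1)
    have h2 : P * (4 * K + c * (16 * K + 15) + 9) ≤ P * (16 * (K + 1) * (c + 1)) := by
      gcongr
      nlinarith
    have h3 := hle_T hP (by nlinarith : 1 ≤ (K + 1) ^ 2) (by lia : 1 ≤ c + n ^ 2 + 1)
    linarith
  have hsums : K * (P * 4 + 4) + 2 ≤ 10 * T := by
    have := hle_T le_rfl (by nlinarith : K + 1 ≤ (K + 1) ^ 2) (by lia : 1 ≤ c + n ^ 2 + 1)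
    nlinarith
  have hsearch : k * (n * (decideTime n K + 4) + 6) + decideTime n K + 5 ≤ 34 * T :=
    (search_time_le hK).trans
      (Nat.mul_le_mul_left 34 (hle_T le_rfl le_rfl (by lia : n ^ 2 + 1 ≤ c + n ^ 2 + 1)))
  linarith

theorem BlockTest.runs_solve {L : ℕ} (h : BlockTest size violTest I K)
    (hL : WordSize I.n I.c K L) :
    Runs L (solve size violTest) I.initial (85 * (2 ^ K * (K + 1) ^ 2 * (I.c + I.n ^ 2 + 1)))
      I.CorrectOutput := by
  obtain ⟨viol, hcrit, htest⟩ := h.exists_criterion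
  refine Runs.mono (Runs.seq (runs_prepare hL h.le h.eval_size I.input_initial) fun m₁ _ hm₁ =>
    Runs.seq (runs_computeWeights hL h.le htest hm₁) fun m₂ _ hm₂ =>
    Runs.seq (runs_sumOverSubsets hL (blockWeight_lt_modulus I.n viol) hm₂.1 hm₂.2)
      fun m₃ _ hm₃ => ?_) (solve_time_le h.le)
  exact (runs_search hL h.le hm₃).conseq le_rfl fun m' _ hout =>
    correctOutput_of_feasible h.le hcrit hout

/-- A word length that is polylogarithmic in the time bound `T`. -/
def wordLength (T : ℕ) : ℕ := (Nat.log 2 (T + 2) + 1) ^ 3 + Nat.log 2 (T + 2) + 1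

theorem one_le_log (T : ℕ) : 1 ≤ Nat.log 2 (T + 2) := Nat.log_pos one_lt_two (by lia)

theorem wordSize_wordLength {n c K T : ℕ} (hK : K ≤ Nat.log 2 (T + 2)) (hT : c + n ^ 2 ≤ T) :
    WordSize n c K (wordLength T) := by
  set l := Nat.log 2 (T + 2) with hl
  have hT_lt : T + 2 < 2 ^ (l + 1) := Nat.lt_pow_succ_log_self one_lt_two _
  refine ⟨?_, ?_⟩
  · calc 2 ^ K * modulus n K = 2 ^ K * (n + 2) ^ ((K + 1) * (K + 1)) := by rw [modulus_eq]
      _ ≤ 2 ^ K * (2 ^ (l + 1)) ^ ((K + 1) * (K + 1)) := by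
        gcongr
        nlinarith
      _ = 2 ^ (K + (l + 1) * ((K + 1) * (K + 1))) := by rw [← pow_mul, ← pow_add]
      _ < 2 ^ wordLength T := by
        refine Nat.pow_lt_pow_right one_lt_two ?_
        have : (l + 1) * ((K + 1) * (K + 1)) ≤ (l + 1) * ((l + 1) * (l + 1)) := by gcongr
        rw [wordLength, ← hl]
        linarith [pow_three (l + 1)]
  · calc c ≤ T + 2 := by lia
      _ < 2 ^ (l + 1) := hT_lt
      _ ≤ 2 ^ wordLength T := Nat.pow_le_pow_right two_pos (by rw [wordLength]; lia)

theorem bounded_initial_wordLength {T : ℕ} (hk : I.k ≤ Nat.log 2 (T + 2))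
    (hT : I.c + I.n ^ 2 ≤ T) : I.initial.Bounded (wordLength T) := by
  set l := Nat.log 2 (T + 2) with hl
  have hT_lt : T + 2 < 2 ^ (l + 1) := Nat.lt_pow_succ_log_self one_lt_two _
  refine I.bounded_initial ?_
  calc I.k + I.n + I.c + 1 < 2 ^ (l + 1) + 2 ^ (l + 1) := by
        have := (hk.trans_lt l.lt_two_pow_self)
        nlinarith [pow_succ 2 l]
    _ = 2 ^ (l + 2) := by ring
    _ ≤ 2 ^ wordLength T := Nat.pow_le_pow_right two_pos (by
        have : 1 ≤ (l + 1) ^ 3 := Nat.one_le_pow 3 _ l.succ_pos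
        rw [wordLength, ← hl]
        lia)

theorem BlockTest.le_log (h : BlockTest size violTest I K) :
    K ≤ Nat.log 2 (2 ^ K * (I.c + I.n ^ 2) + 2) := by
  rcases (I.c + I.n ^ 2).eq_zero_or_pos with h0 | h0
  · simp [h.eq_zero h0]
  · exact Nat.le_log_of_pow_le one_lt_two (by nlinarith [Nat.one_le_two_pow (n := K)])

theorem BlockTest.wordSize (h : BlockTest size violTest I K) :
    WordSize I.n I.c K (wordLength (2 ^ K * (I.c + I.n ^ 2))) :=
  wordSize_wordLength h.le_log (Nat.le_mul_of_pos_left _ (by positivity))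

theorem BlockTest.bounded_initial (h : BlockTest size violTest I K) :
    I.initial.Bounded (wordLength (2 ^ K * (I.c + I.n ^ 2))) :=
  bounded_initial_wordLength (h.le.trans h.le_log) (Nat.le_mul_of_pos_left _ (by positivity))

theorem BlockTest.cost_le (h : BlockTest size violTest I K) {T : ℕ}
    (hT : T = 2 ^ K * (I.c + I.n ^ 2)) :
    (wordLength T + 1) * (85 * (2 ^ K * (K + 1) ^ 2 * (I.c + I.n ^ 2 + 1)) + 1)
      ≤ 7568 * (T + 1) * Nat.log 2 (T + 2) ^ 5 := by
  have hK := h.le_log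
  rw [← hT] at hK
  have hl := one_le_log T
  set l := Nat.log 2 (T + 2)
  have hword : wordLength T + 1 ≤ 11 * l ^ 3 := by
    calc wordLength T + 1 = (l + 1) ^ 3 + l + 2 := by rw [wordLength]
      _ ≤ (2 * l) ^ 3 + l ^ 3 + 2 * l ^ 3 := by
        gcongr
        exacts [by lia, Nat.le_self_pow three_ne_zero l,
          Nat.le_mul_of_pos_right 2 (by positivity)]
      _ = 11 * l ^ 3 := by ring
  have hcard : (K + 1) ^ 2 ≤ 4 * l ^ 2 := by nlinarith
  have hsets : 2 ^ K * (I.c + I.n ^ 2 + 1) ≤ 2 * (T + 1) := by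
    rcases (I.c + I.n ^ 2).eq_zero_or_pos with h0 | h0
    · simp only [h.eq_zero h0, h0, pow_zero]
      lia
    · nlinarith
  calc _ ≤ (wordLength T + 1) * (86 * (2 ^ K * (K + 1) ^ 2 * (I.c + I.n ^ 2 + 1))) := by
        have : 1 ≤ 2 ^ K * (K + 1) ^ 2 * (I.c + I.n ^ 2 + 1) :=
          Nat.mul_pos (by positivity) (Nat.succ_pos _)
        gcongr
        lia
    _ = (wordLength T + 1) * 86 * (K + 1) ^ 2 * (2 ^ K * (I.c + I.n ^ 2 + 1)) := by ring
    _ ≤ 11 * l ^ 3 * 86 * (4 * l ^ 2) * (2 * (T + 1)) := by gcongr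
    _ = 7568 * (T + 1) * l ^ 5 := by ring

theorem solvableInSoftO_of_blockTest {Q : Instance → Prop} (K : Instance → ℕ)
    (h : ∀ I, Q I → BlockTest size violTest I (K I)) :
    SolvableInSoftO Q fun I => 2 ^ K I * (I.c + I.n ^ 2) := by
  refine ⟨(solve size violTest).weight * 7568, 5, solve size violTest, fun I hI => ?_⟩
  obtain ⟨m, t, he, ht, -, hout⟩ := (h I hI).runs_solve (h I hI).wordSize (h I hI).bounded_initial
  have hcost := (h I hI).cost_le rfl
  refine ⟨m, t, he, hout, ht.trans ?_⟩
  simp only [mul_assoc (solve size violTest).weight] at hcost ⊢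
  exact Nat.mul_le_mul_left _ ((Nat.mul_le_mul_left _ (Nat.le_succ _)).trans hcost)

end Time

section Tests

variable {k n K : ℕ} {W : Schema (Fin k) (Fin n)} {hK : k ≤ K}

/-- Decides whether the current set violates a Type 2 constraint. -/
def type2Test : Expr :=
  .add (.mul (Expr.ne (.var rSingle) (.lit 1)).not (.mul (.var rLeft) (Expr.var rRight).not))
    (.mul (Expr.ne (.var rSingle) (.lit 1)) (.mul (.var rRight) (Expr.var rLeft).not))

theorem testsViolation_type2 :
    TestsViolation (W := W) le_rfl type2Test fun V g => Type2Violated V (W.constraints.get g) := by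
  intro V g m hm
  have hleft : (Expr.var rLeft).Holds m ↔ Meets id V (W.constraints.get g).left := by
    simpa [Expr.Holds] using hm.meets_left
  have hright : (Expr.var rRight).Holds m ↔ Meets id V (W.constraints.get g).right := by
    simpa [Expr.Holds] using hm.meets_right
  simp only [type2Test, Type2Violated, Expr.holds_add, Expr.holds_mul, Expr.holds_not,
    Expr.holds_ne, hleft, hright, Expr.eval_var, Expr.eval, hm.single, not_not]

/-- Decides whether the current set contains the element `x` but misses one of the two sets of the
current constraint. -/
def witnessTest (x : Expr) : Expr := .mul (memBit x) (Expr.mul (.var rLeft) (.var rRight)).not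

theorem testsViolation_witness {x : Expr} {elt : Fin W.constraints.length → Fin K}
    (hx : ∀ V g m, Counted W hK V g m → x.eval m = elt g) :
    TestsViolation hK (witnessTest x) fun V g =>
      WitnessViolated (Fin.castLE hK) (elt g) V (W.constraints.get g) := by
  intro V g m hm
  have hmem : (memBit x).Holds m ↔ elt g ∈ V := by
    rw [Expr.Holds, hm.eval_memBit hm.set (hx V g m hm), bit_ne_zero]
  have hleft : (Expr.var rLeft).Holds m ↔ Meets (Fin.castLE hK) V (W.constraints.get g).left :=
    hm.meets_left
  have hright : (Expr.var rRight).Holds m ↔ Meets (Fin.castLE hK) V (W.constraints.get g).right :=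
    hm.meets_right
  rw [witnessTest, Expr.holds_mul, Expr.holds_not, Expr.holds_mul, hmem, hleft, hright]
  rfl

theorem castLE_ne_natAdd {l : ℕ} (h : k ≤ k + l) (s : Fin k) (x : Fin l) :
    Fin.castLE h s ≠ Fin.natAdd k x :=
  Fin.ne_of_val_ne (by rw [Fin.val_castLE, Fin.val_natAdd]; lia)

theorem Instance.users_pos (I : Instance) (hk : 0 < I.k) : 0 < I.n :=
  (I.schema.exists_auth ⟨0, hk⟩).choose.pos

theorem blockTest_type2 {I : Instance} (hI : WSP2Eq I) : BlockTest numSteps type2Test I I.k where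
  le := le_rfl
  eq_zero h := by
    by_contra hk
    have := I.users_pos (Nat.pos_of_ne_zero hk)
    simp_all
  eval_size m hm _ := hm.eval_numSteps
  exists_criterion := ⟨_, by
    rw [Fin.castLE_rfl]
    exact blockCriterion_type2 I.schema hI.1 hI.2, testsViolation_type2⟩

theorem solvable_wsp2Eq : SolvableInSoftO WSP2Eq fun I => 2 ^ I.k * (I.c + I.n ^ 2) :=
  solvableInSoftO_of_blockTest Instance.k fun _ => blockTest_type2

theorem blockTest_constraints {I : Instance} (hI : WSPEq I) :
    BlockTest (.add numSteps numConstraints) (witnessTest (.add numSteps (.var rCon))) I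
      (I.k + I.c) where
  le := Nat.le_add_right _ _
  eq_zero h := by
    by_contra hk
    have := I.users_pos (by lia)
    simp_all
  eval_size m hm _ := by rw [Expr.eval, hm.eval_numSteps, hm.eval_numConstraints]; rfl
  exists_criterion := by
    refine ⟨_, blockCriterion_witness I.schema hI (Fin.castLE_injective _)
      (fun g => Fin.natAdd I.k g) (fun g g' h => ?_) (fun g s => castLE_ne_natAdd _ s _)
      (fun x => Or.inl ?_), testsViolation_witness fun V g m hm => ?_⟩
    · rw [(Fin.natAdd_injective _ _) h]
    · induction x using Fin.addCases with
      | left s => exact Or.inl ⟨s, rfl⟩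
      | right g => exact Or.inr ⟨g, rfl⟩
    · rw [Expr.eval, hm.toInput.eval_numSteps, Expr.eval_var, hm.con]
      rfl

theorem solvable_wspEq : SolvableInSoftO WSPEq fun I => 2 ^ (I.k + I.c) * (I.c + I.n ^ 2) :=
  solvableInSoftO_of_blockTest (fun I => I.k + I.c) fun _ => blockTest_constraints

theorem blockTest_pairs {I : Instance} (hI : WSPEq I) (hk : 0 < I.k) :
    BlockTest (.add numSteps (.mul (.load aTwo numSteps) (.load aTwo numSteps)))
      (witnessTest (.add numSteps (.var rPair))) I (I.k + 4 ^ I.k) where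
  le := Nat.le_add_right _ _
  eq_zero h := by
    have := I.users_pos hk
    simp_all
  eval_size m hm htwo := by
    simp only [Expr.eval, hm.eval_numSteps, htwo _ le_rfl, ← mul_pow]
    rfl
  exists_criterion := by
    refine ⟨_, blockCriterion_witness I.schema hI (Fin.castLE_injective _)
      (fun g => Fin.natAdd I.k (pairCode (I.schema.constraints.get g))) (fun g g' h => ?_)
      (fun g s => castLE_ne_natAdd _ s _) (fun x => Or.inr ⟨0, I.users_pos hk⟩),
      testsViolation_witness fun V g m hm => ?_⟩
    · exact injOn_pairCode (hI _ (List.get_mem _ _)) (hI _ (List.get_mem _ _))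
        (Fin.natAdd_injective _ _ h)
    · rw [Expr.eval, hm.toInput.eval_numSteps, Expr.eval_var, hm.pair]
      rfl

end Tests

section FixedParameter

variable (I : Instance)

theorem Instance.length_encode_le_inputSize : I.encode.length ≤ I.inputSize := by
  simp [inputSize, List.sum_map_add]

theorem Instance.one_le_inputSize : 1 ≤ I.inputSize :=
  le_trans (by simp [encode]) I.length_encode_le_inputSize

theorem Instance.add_le_inputSize (hk : 0 < I.k) : I.k + I.n + I.c ≤ I.inputSize := by
  have hlen := I.length_encode_le_inputSize
  rw [encode_eq] at hlen
  simp only [List.length_append, length_orderTable, length_authTable, length_constraintTable,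
    List.length_cons, List.length_nil] at hlen
  nlinarith

theorem Instance.bounded_initial_inputSize : I.initial.Bounded I.inputSize := by
  intro a i
  unfold initial
  split_ifs
  · rcases lt_or_ge i I.encode.length with hi | hi
    · rw [List.getD_eq_getElem _ _ hi]
      refine Nat.lt_size_self _ |>.trans_le (Nat.pow_le_pow_right two_pos ?_)
      exact (Nat.le_succ _).trans
        (List.single_le_sum (by simp) _ (List.mem_map_of_mem (List.getElem_mem hi)))
    · rw [List.getD_eq_default _ _ hi]
      positivity
  · positivity

/-- Uses one extra element of the ground set for each pair of sets of steps. If there are no steps,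
the numbers of users and constraints may be exponential in the input size, but then only the empty
plan has to be checked, which satisfies no constraint. -/
def solveFPT : Program :=
  .branch numSteps
    (solve (.add numSteps (.mul (.load aTwo numSteps) (.load aTwo numSteps)))
      (witnessTest (.add numSteps (.var rPair))))
    (.store aOut (.lit 0) numConstraints.not)

theorem correctOutput_of_no_steps (hk : I.k = 0) {m : Memory} (hm : Input I.schema m) :
    I.CorrectOutput (m.write aOut 0 (numConstraints.not.eval m)) := by
  have hempty : IsEmpty (Fin I.k) := by rw [hk]; infer_instance
  have hvalid (π : Fin I.k → Fin I.n) : I.schema.Valid π ↔ I.schema.constraints = [] := by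
    simp [Schema.Valid, EntailmentConstraint.Satisfied, List.eq_nil_iff_forall_not_mem]
  have hout : m.write aOut 0 (numConstraints.not.eval m) 1 0
      = 1 - I.schema.constraints.length := by
    simp [Expr.not, Expr.eval, hm.eval_numConstraints]
  rw [Instance.CorrectOutput, hout]
  rcases h : I.schema.constraints with _ | ⟨γ, C⟩
  · exact Or.inl ⟨isEmptyElim, (hvalid _).2 h, rfl, isEmptyElim⟩
  · exact Or.inr ⟨fun ⟨π, hπ⟩ => by simp [(hvalid π).1 hπ] at h, by simp⟩

theorem mul_log_pow_le {k n c N K : ℕ} (hN : k + n + c ≤ N) (hk : 0 < k) :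
    (2 ^ K * (c + n ^ 2) + 1) * Nat.log 2 (2 ^ K * (c + n ^ 2) + 2) ^ 5
      ≤ 2 ^ (6 * (K + 1)) * N ^ 12 := by
  have hlog := Nat.log_le_self 2 (2 ^ K * (c + n ^ 2) + 2)
  calc _ ≤ (2 ^ K * (c + n ^ 2) + 2) * (2 ^ K * (c + n ^ 2) + 2) ^ 5 := by gcongr; lia
    _ = (2 ^ K * (c + n ^ 2) + 2) ^ 6 := by ring
    _ ≤ (2 ^ (K + 1) * N ^ 2) ^ 6 := by
      gcongr
      have hP : 1 ≤ 2 ^ K := Nat.one_le_two_pow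
      have hsum : c + n ^ 2 + 2 ≤ 2 * (k + n + c) ^ 2 := by
        obtain ⟨j, rfl⟩ := Nat.exists_eq_succ_of_ne_zero hk.ne'
        lia
      calc 2 ^ K * (c + n ^ 2) + 2 ≤ 2 ^ K * (c + n ^ 2 + 2) := by linarith
        _ ≤ 2 ^ K * (2 * (k + n + c) ^ 2) := by gcongr
        _ ≤ 2 ^ K * (2 * N ^ 2) := by gcongr
        _ = 2 ^ (K + 1) * N ^ 2 := by ring
    _ = 2 ^ (6 * (K + 1)) * N ^ 12 := by rw [mul_pow, ← pow_mul, ← pow_mul, mul_comm (K + 1)]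

theorem computable_const_mul_two_pow (C : ℕ) :
    Computable fun k => C * 2 ^ (6 * (k + 4 ^ k + 1)) := by
  have hpow : Primrec₂ fun a b : ℕ => a ^ b := Primrec₂.unpaired'.1 Nat.Primrec.pow
  have hexp : Primrec fun k => 6 * (k + 4 ^ k + 1) :=
    Primrec.nat_mul.comp (.const 6)
      (Primrec.succ.comp (Primrec.nat_add.comp .id (hpow.comp (.const 4) .id)))
  exact (Primrec.nat_mul.comp (.const C) (hpow.comp (.const 2) hexp)).to_comp

theorem runs_solveFPT_of_no_steps (hk : I.k = 0) :
    Runs I.inputSize solveFPT I.initial 2 I.CorrectOutput := by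
  have hin := I.input_initial
  refine Runs.branch (τ := 1) (fun h => absurd (hin.eval_numSteps.trans hk) h) fun _ =>
    Runs.store ?_ (correctOutput_of_no_steps I hk hin)
  calc (numConstraints.not).eval I.initial < 2 ^ 1 := Nat.lt_succ_of_le (Nat.sub_le _ _)
    _ ≤ 2 ^ I.inputSize := Nat.pow_le_pow_right two_pos I.one_le_inputSize

theorem runs_solveFPT_of_pos {K : ℕ} (hK : K = I.k + 4 ^ I.k) (hI : WSPEq I) (hk : 0 < I.k) :
    Runs (wordLength (2 ^ K * (I.c + I.n ^ 2))) solveFPT I.initial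
      (1 + 85 * (2 ^ K * (K + 1) ^ 2 * (I.c + I.n ^ 2 + 1))) I.CorrectOutput := by
  subst hK
  have hblock := blockTest_pairs hI hk
  exact Runs.branch (fun _ => hblock.runs_solve hblock.wordSize)
    fun h => absurd (I.input_initial.eval_numSteps.symm.trans h) hk.ne'

theorem isFPT_wspEq : IsFPT WSPEq := by
  refine ⟨_, computable_const_mul_two_pow (solveFPT.weight * 7568), 12, solveFPT, fun I hI => ?_⟩
  rcases I.k.eq_zero_or_pos with hk | hk
  · obtain ⟨m, t, he, ht, -, hout⟩ :=
      runs_solveFPT_of_no_steps I hk I.bounded_initial_inputSize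
    refine ⟨m, t, he, hout, ht.trans ?_⟩
    have hsize : 1 ≤ I.inputSize := I.one_le_inputSize
    calc solveFPT.weight * (I.inputSize + 1) * 2
        ≤ solveFPT.weight * (2 * I.inputSize) * 2 := by gcongr; lia
      _ = solveFPT.weight * 4 * 1 * I.inputSize ^ 1 := by ring
      _ ≤ solveFPT.weight * 7568 * 2 ^ (6 * (I.k + 4 ^ I.k + 1)) * I.inputSize ^ 12 := by
        gcongr
        exacts [by norm_num, Nat.one_le_two_pow, by norm_num]
  · have hblock := blockTest_pairs hI hk
    obtain ⟨m, t, he, ht, -, hout⟩ := runs_solveFPT_of_pos I rfl hI hk hblock.bounded_initial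
    have hcost := (hblock.cost_le rfl).trans ((mul_assoc _ _ _).trans_le
      (Nat.mul_le_mul_left 7568 (mul_log_pow_le (I.add_le_inputSize hk) hk)))
    refine ⟨m, t, he, hout, ht.trans ?_⟩
    simp only [mul_assoc solveFPT.weight, mul_assoc 7568, add_comm 1]
    exact Nat.mul_le_mul_left _ hcost

end FixedParameter

end Solver

end WSP

theorem theorem5 :
    WSP.SolvableInSoftO WSP.WSP2Eq (fun I => 2 ^ I.k * (I.c + I.n ^ 2)) ∧
    WSP.SolvableInSoftO WSP.WSPEq (fun I => 2 ^ (I.k + I.c) * (I.c + I.n ^ 2)) ∧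
    (∀ I : WSP.Instance, WSP.WSPEq I →
      ∃ C : List (WSP.EntailmentConstraint (Fin I.k) (Fin I.n)),
        C.Sublist I.schema.constraints ∧ C.length ≤ 3 ^ I.k ∧
        ∀ π : Fin I.k → Fin I.n,
          I.schema.Valid π ↔ (I.schema.withConstraints C).Valid π) ∧
    WSP.IsFPT WSP.WSPEq :=
  ⟨WSP.solvable_wsp2Eq, WSP.solvable_wspEq,
    fun I hI => by simpa using WSP.exists_sublist_constraints I.schema hI, WSP.isFPT_wspEq⟩
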